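/- Let $X$ be a second countable locally compact Hausdorff space, and let $C_0(X)$ be the $C^*$-algebra of continuous complex-valued functions on $X$ vanishing at infinity. Then $$\dim X = \operatorname{cpr}(C_0(X)),$$ where the two sides (integers $\ge -1$, or $\infty$) are defined as follows. *Covering dimension.* For an integer $n\ge -1$, $\dim X\le n$ means that every finite open covering of $X$ has an open refinement $(V_\lambda)_{\lambda\in\Lambda}$ (again a covering of $X$) of order not exceeding $n$, i.e. $\bigcap_{i=0}^{n+1}V_{\lambda_i}=\emptyset$ for any $n+2$ distinct indices $\lambda_0,\dots,\lambda_{n+1}\in\Lambda$. $\dim X$ is the least integer $n\ge -1$ with $\dim X\le n$, and $\infty$ if there is none. *Completely positive rank.* Elements $x,y$ of a $C^*$-algebra are orthogonal, $x\perp y$, if $xy=yx=x^*y=xy^*=0$. Let $F$ be a finite-dimensional $C^*$-algebra. A finite subset of $F$ is elementary if it consists of mutually orthogonal minimal projections. A completely positive map $\varphi:F\to A$ into a $C^*$-algebra $A$ has strict order not exceeding $n$ if for every elementary set $\{e_0,\dots,e_{n+1}\}\subset F$ with $n+2$ elements there are $i,j\in\{0,\dots,n+1\}$ with $\varphi(e_i)\perp\varphi(e_j)$.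 For an integer $n\ge -1$, $\operatorname{cpr}A\le n$ means that for all $a_1,\dots,a_k\in A$ and $\varepsilon>0$ there are a finite-dimensional $C^*$-algebra $F$ and completely positive contractions $\psi:A\to F$, $\varphi:F\to A$ with $\|\varphi\psi(a_i)-a_i\|<\varepsilon$ for all $i$ such that the strict order of $\varphi$ does not exceed $n$. $\operatorname{cpr}A$ is the least integer $n\ge -1$ with $\operatorname{cpr}A\le n$, and $\infty$ if there is none. -/

import Mathlib

open TopologicalSpace
open scoped ZeroAtInfty CStarAlgebra

universe u

/-! ### Covering dimension -/

/-- The order of a family `V` of subsets of `X` does not exceed `n`: any `n + 2` members of the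
family with distinct indices have empty intersection. -/
def FamilyOrderLE {X κ : Type*} (V : κ → Set X) (n : ℤ) : Prop :=
  ∀ s : Finset κ, (s.card : ℤ) = n + 2 → ⋂ i ∈ s, V i = ∅

/-- `dim X ≤ n`: every finite open covering of `X` has an open refinement (again a covering of `X`,
not necessarily finite) of order not exceeding `n`.
Since repeating a member can only increase the order, it is no restriction
to index refinements by types in the universe of `X`. -/
def CoveringDimLE (X : Type u) [TopologicalSpace X] (n : ℤ) : Prop :=
  ∀ (k : ℕ) (U : Fin k → Opens X), IsOpenCover U →
    ∃ (κ : Type u) (V : κ → Opens X),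
      IsOpenCover V ∧ (∀ j, ∃ i, V j ≤ U i) ∧ FamilyOrderLE (fun j => (V j : Set X)) n

/-- The covering dimension of `X`: the least integer `n ≥ -1` with `dim X ≤ n`, and `⊤` if there is
none. The value `-1` is taken exactly by the empty space. -/
noncomputable def coveringDim (X : Type u) [TopologicalSpace X] : WithTop ℤ :=
  sInf {d | ∃ n : ℤ, -1 ≤ n ∧ CoveringDimLE X n ∧ d = (n : WithTop ℤ)}

/-! ### Completely positive rank -/

/-- Orthogonality `x ⊥ y` of elements of a C⋆-algebra. -/
def CStarOrthogonal {A : Type*} [NonUnitalCStarAlgebra A] (x y : A) : Prop :=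
  x * y = 0 ∧ y * x = 0 ∧ star x * y = 0 ∧ x * star y = 0

/-- Minimal projections: nonzero projections `e` such that the only projections `q ≤ e` are `0`
and `e`. -/
def IsMinimalProjection {F : Type*} [NonUnitalCStarAlgebra F] [PartialOrder F] (e : F) : Prop :=
  IsStarProjection e ∧ e ≠ 0 ∧ ∀ q : F, IsStarProjection q → q ≤ e → q = 0 ∨ q = e

/-- A finite subset of `F` is elementary if it consists of mutually orthogonal minimal
projections. -/
def IsElementary {F : Type*} [NonUnitalCStarAlgebra F] [PartialOrder F] (s : Finset F) : Prop :=
  (∀ e ∈ s, IsMinimalProjection e) ∧ (s : Set F).Pairwise CStarOrthogonal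

/-- The strict order of a map `φ : F → A` does not exceed `n`: every elementary set with `n + 2`
elements contains `e, f` with `φ e ⊥ φ f`. (For `n ≥ 0` it makes no difference whether `e` and `f`
are required to be distinct.) -/
def StrictOrderLE {F A : Type*} [NonUnitalCStarAlgebra F] [PartialOrder F]
    [NonUnitalCStarAlgebra A] (φ : F → A) (n : ℤ) : Prop :=
  ∀ s : Finset F, (s.card : ℤ) = n + 2 → IsElementary s →
    ∃ e ∈ s, ∃ f ∈ s, CStarOrthogonal (φ e) (φ f)

/-- `cpr A ≤ n`: for all `a₁, …, aₖ ∈ A` and `ε > 0` there is a completely positive approximation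
`(F, ψ, φ)` within `ε` (that is, `F` is a finite-dimensional C⋆-algebra and `ψ : A → F`, `φ : F → A`
are completely positive contractions with `‖φ (ψ aᵢ) - aᵢ‖ < ε`) such that the strict order of `φ`
does not exceed `n`.
Finite-dimensional C⋆-algebras are automatically unital, and each one is isomorphic to one in
`Type`. The orders on `A` and `F` are the usual ones: `StarOrderedRing` determines them. -/
def CPRankLE (A : Type u) [NonUnitalCStarAlgebra A] [PartialOrder A] [StarOrderedRing A]
    (n : ℤ) : Prop :=
  ∀ (k : ℕ) (a : Fin k → A) (ε : ℝ), 0 < ε →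
    ∃ (F : Type) (_ : CStarAlgebra F) (_ : PartialOrder F) (_ : StarOrderedRing F)
      (ψ : A →CP F) (φ : F →CP A),
      FiniteDimensional ℂ F ∧ (∀ x, ‖ψ x‖ ≤ ‖x‖) ∧ (∀ y, ‖φ y‖ ≤ ‖y‖) ∧
      (∀ i, ‖φ (ψ (a i)) - a i‖ < ε) ∧ StrictOrderLE φ n

/-- The completely positive rank of a C⋆-algebra `A` (with its standard order): the least integer
`n ≥ -1` with `cpr A ≤ n`, and `⊤` if there is none. The value `-1` is taken exactly by `A = 0`. -/
noncomputable def cpRank (A : Type u) [NonUnitalCStarAlgebra A] : WithTop ℤ :=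
  letI : PartialOrder A := CStarAlgebra.spectralOrder A
  haveI : StarOrderedRing A := CStarAlgebra.spectralOrderedRing A
  sInf {d | ∃ n : ℤ, -1 ≤ n ∧ CPRankLE A n ∧ d = (n : WithTop ℤ)}

/-! ### Projections in finite-dimensional C⋆-algebras -/

section Projections

variable {F : Type*} [CStarAlgebra F]

/-! Put `m = n + 1`; both bounds then say that some multiplicity is at most `m`.

From dimension to rank: outside a compact set the given functions are small, and over it there is a
fine subpartition of unity `(gᵢ)` in `m` colours, functions of equal colour having product zero.
Evaluation at sample points followed by `y ↦ ∑ yᵢ gᵢ` approximates the identity through `ℂ^ι`.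
Minimal projections there are coordinate vectors, so two among any `m + 1` share a colour and have
orthogonal images (`CoveringDimLE.exists_coloured_subpartition`, `CoveringDimLE.cpRankLE`).

From rank to dimension: the sum theorem `exists_refinement_of_compact` reduces to covers of a
compact `K`. Take a partition of unity `fᵢ` on `K` subordinate to the cover, approximate the `fᵢ`,
the `fᵢ²` and a local unit through `F`, and let `cᵢ = ψ fᵢ`. Each point `x` gives a positive
functional `y ↦ Re (φ y x)`, and strict order allows at most `m` orthogonal minimal projections of
positive mass. A rotation argument then confines the functional to a central summand of total matrix
size at most `m` (`exists_central_support`). By Kadison–Schwarz the mass of `(cᵢ - fᵢ(x))²` is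
small, so a Chebyshev estimate (`exists_minimalProjection_norm_le`) finds a minimal projection of
positive mass that is an approximate joint eigenprojection for the values `fᵢ(x)`.

Points are sorted by the matrix block containing this projection. Blocks occurring at one point have
total size at most `m`; within a block of size `d` at most `d` mutually separated tuples of values
occur, because approximate eigenvectors for separated values are almost orthogonal. Hence `d` sets
of small oscillation suffice for that block, the whole family has multiplicity at most `m`
(`exists_cover_of_approx_eigenvectors`), and small oscillation puts each set inside some `Uᵢ`. -/

theorem spectrum_real_finite [FiniteDimensional ℂ F] (a : F) : (spectrum ℝ a).Finite := by
  have hint : IsIntegral ℂ a := Algebra.IsIntegral.isIntegral a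
  have h : (spectrum ℂ a).Finite := by
    refine ((minpoly ℂ a).rootSet_finite ℂ).subset fun z hz => ?_
    have h1 := spectrum.subset_polynomial_aeval a (minpoly ℂ a) ⟨z, hz, rfl⟩
    have : Nontrivial F := by
      by_contra hn
      rw [not_nontrivial_iff_subsingleton] at hn
      simp [spectrum.of_subsingleton] at hz
    rw [minpoly.aeval, spectrum.zero_eq, Set.mem_singleton_iff] at h1
    rw [Polynomial.mem_rootSet]
    exact ⟨minpoly.ne_zero hint, by simpa using h1⟩
  rw [← spectrum.preimage_algebraMap (R := ℝ) (S := ℂ)]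
  exact h.preimage (FaithfulSMul.algebraMap_injective ℝ ℂ).injOn

/-- Every function is continuous on a finite spectrum, so the continuous functional calculus already
supplies all spectral projections. -/
theorem isStarProjection_cfc_indicator [FiniteDimensional ℂ F] (a : F) (s : Set ℝ) :
    IsStarProjection (cfc (s.indicator (1 : ℝ → ℝ)) a) := by
  have hc (f : ℝ → ℝ) : ContinuousOn f (spectrum ℝ a) := (spectrum_real_finite a).continuousOn f
  refine ⟨?_, cfc_predicate _ _⟩
  rw [IsIdempotentElem, ← cfc_mul _ _ a (hc _) (hc _)]
  congr 1
  ext x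
  by_cases hx : x ∈ s <;> simp [hx]

theorem mul_eq_self_of_star_mul_self {v e : F} (he : IsStarProjection e) (h : star v * v = e) :
    v * e = v := by
  have h1 : e * e = e := he.isIdempotentElem
  have h2 : star e = e := he.isSelfAdjoint
  have : star (v * e - v) * (v * e - v) = 0 := by
    simp only [star_sub, star_mul, h2, sub_mul, mul_sub, mul_assoc, h]
    rw [← mul_assoc (star v) v e, h, h1]
    simp [h1]
  exact sub_eq_zero.1 (CStarRing.star_mul_self_eq_zero_iff _ |>.1 this)

/-- Murray–von Neumann equivalence. -/
def MvNEquiv (e q : F) : Prop := ∃ v : F, star v * v = e ∧ v * star v = q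

theorem isStarProjection_mul_star {v e : F} (he : IsStarProjection e) (h : star v * v = e) :
    IsStarProjection (v * star v) := by
  refine ⟨?_, IsSelfAdjoint.mul_star_self v⟩
  rw [IsIdempotentElem, mul_assoc, ← mul_assoc (star v), h, ← mul_assoc,
    mul_eq_self_of_star_mul_self he h]

theorem MvNEquiv.symm {e q : F} : MvNEquiv e q → MvNEquiv q e := by
  rintro ⟨v, h1, h2⟩
  exact ⟨star v, by simpa using h2, by simpa using h1⟩

theorem MvNEquiv.refl {e : F} (he : IsStarProjection e) : MvNEquiv e e :=
  ⟨e, by rw [he.isSelfAdjoint.star_eq, he.isIdempotentElem.eq],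
    by rw [he.isSelfAdjoint.star_eq, he.isIdempotentElem.eq]⟩

theorem MvNEquiv.trans {e q r : F} (he : IsStarProjection e) (hr : IsStarProjection r) :
    MvNEquiv e q → MvNEquiv q r → MvNEquiv e r := by
  rintro ⟨v, h1, h2⟩ ⟨w, h3, h4⟩
  refine ⟨w * v, ?_, ?_⟩
  · have : v * e = v := mul_eq_self_of_star_mul_self he h1
    rw [star_mul, mul_assoc, ← mul_assoc (star w), h3, ← h2, mul_assoc v, h1, this, h1]
  · have : star w * r = star w := mul_eq_self_of_star_mul_self hr (by simpa using h4)
    have h5 : r * w = w := by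
      simpa [hr.isSelfAdjoint.star_eq] using congr(star $this)
    rw [star_mul, mul_assoc, ← mul_assoc v, h2, ← h3, mul_assoc (star w), h4, this, h4]

variable [PartialOrder F] [StarOrderedRing F]

theorem IsStarProjection.le_iff_mul_eq {p q : F} (hp : IsStarProjection p)
    (hq : IsStarProjection q) : p ≤ q ↔ p * q = p :=
  ⟨fun h => (hq.mul_right_and_mul_left_of_nonneg_of_le hp.nonneg h).1,
    fun h => hp.le_of_mul_eq_left hq h⟩

/-- The spectral projection of `a` at a nonzero eigenvalue lies below `e`, so by minimality it
equals `e`. -/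
theorem IsMinimalProjection.exists_eq_smul [FiniteDimensional ℂ F] {e a : F}
    (he : IsMinimalProjection e) (ha : IsSelfAdjoint a) (hae : a * e = a) :
    ∃ r : ℝ, (0 ≤ a → 0 ≤ r) ∧ a = (r : ℂ) • e := by
  have hc (f : ℝ → ℝ) : ContinuousOn f (spectrum ℝ a) := (spectrum_real_finite a).continuousOn f
  by_cases h0 : ∀ x ∈ spectrum ℝ a, x = 0
  · refine ⟨0, fun _ => le_rfl, ?_⟩
    have : a = 0 := by
      rw [← cfc_id ℝ a, ← cfc_zero ℝ a]
      exact cfc_congr fun x hx => by simpa using h0 x hx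
    simp [this]
  push Not at h0
  obtain ⟨r, hr, hr0⟩ := h0
  refine ⟨r, fun h => spectrum_nonneg_of_nonneg h hr, ?_⟩
  set p := cfc (({r} : Set ℝ).indicator (1 : ℝ → ℝ)) a with hp
  have hpp : IsStarProjection p := isStarProjection_cfc_indicator a _
  have hap : a * p = r • p := by
    conv_lhs => rw [← cfc_id ℝ a]
    rw [hp, cfc_id ℝ a, ← cfc_smul r _ a (hc _)]
    conv_lhs => enter [1]; rw [← cfc_id ℝ a]
    rw [← cfc_mul _ _ a (hc _) (hc _)]
    congr 1
    ext x
    by_cases hx : x = r <;> simp [hx]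
  have hpa : p * a = r • p := by
    simpa [hpp.isSelfAdjoint.star_eq, ha.star_eq] using congr(star $hap)
  have hpe : p * e = p := by
    have : r • (p * e) = r • p := by rw [← smul_mul_assoc, ← hpa, mul_assoc, hae]
    exact (smul_right_injective F hr0) this
  have hpne : p ≠ 0 := by
    intro h
    rw [hp, ← cfc_zero ℝ a, cfc_eq_cfc_iff_eqOn ha (hc _) (hc _)] at h
    simpa using h hr
  rcases he.2.2 p hpp ((hpp.le_iff_mul_eq he.1).2 hpe) with h | h
  · exact absurd h hpne
  · rw [h, hae] at hap
    rw [hap]; simp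

theorem IsMinimalProjection.exists_corner_eq_smul [FiniteDimensional ℂ F] {e : F}
    (he : IsMinimalProjection e) (a : F) : ∃ c : ℂ, e * a * e = c • e := by
  have hee : e * e = e := he.1.isIdempotentElem
  have hes : star e = e := he.1.isSelfAdjoint
  have key (b : F) (hb : IsSelfAdjoint b) : ∃ r : ℝ, e * b * e = (r : ℂ) • e := by
    obtain ⟨r, -, hr⟩ := he.exists_eq_smul (a := e * b * e)
      (by rw [IsSelfAdjoint]; simp [hes, hb.star_eq, mul_assoc]) (by simp [mul_assoc, hee])
    exact ⟨r, hr⟩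
  obtain ⟨r, hr⟩ := key _ (realPart a).2
  obtain ⟨s, hs⟩ := key _ (imaginaryPart a).2
  refine ⟨r + s * Complex.I, ?_⟩
  conv_lhs => rw [← realPart_add_I_smul_imaginaryPart a]
  rw [mul_add, add_mul, hr, mul_smul_comm, smul_mul_assoc, hs, add_smul, smul_smul, mul_comm]

/-- The dimension of `pF` is the measure on which the inductions over projections terminate. -/
theorem IsStarProjection.finrank_range_mulLeft_lt [FiniteDimensional ℂ F] {p q : F}
    (hp : IsStarProjection p) (hq : IsStarProjection q) (hle : p ≤ q) (hne : p ≠ q) :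
    Module.finrank ℂ (LinearMap.range (LinearMap.mulLeft ℂ p)) <
      Module.finrank ℂ (LinearMap.range (LinearMap.mulLeft ℂ q)) := by
  have hpq := (hp.le_iff_mul_eq hq).1 hle
  have hqp : q * p = p := by
    simpa [hp.isSelfAdjoint.star_eq, hq.isSelfAdjoint.star_eq] using congr(star $hpq)
  apply Submodule.finrank_lt_finrank_of_lt
  refine lt_of_le_of_ne ?_ fun h => hne ?_
  · rintro _ ⟨x, rfl⟩
    exact ⟨p * x, by simp [← mul_assoc, hqp]⟩
  · have : q ∈ LinearMap.range (LinearMap.mulLeft ℂ p) := by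
      rw [h]; exact ⟨1, by simp⟩
    obtain ⟨x, hx⟩ := this
    simp only [LinearMap.mulLeft_apply] at hx
    rw [← hpq, ← hx, ← mul_assoc, hp.isIdempotentElem.eq]

theorem IsStarProjection.exists_minimal_le [FiniteDimensional ℂ F] {p : F}
    (hp : IsStarProjection p) (h0 : p ≠ 0) : ∃ e : F, IsMinimalProjection e ∧ e ≤ p := by
  induction hn : Module.finrank ℂ (LinearMap.range (LinearMap.mulLeft ℂ p)) using
    Nat.strong_induction_on generalizing p with
  | _ n ih =>
    by_cases hm : IsMinimalProjection p
    · exact ⟨p, hm, le_rfl⟩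
    · simp only [IsMinimalProjection, not_and, not_forall, not_or] at hm
      obtain ⟨q, hq, hqp, hq0, hqne⟩ := hm hp h0
      obtain ⟨e, he, heq⟩ := ih _ (hn ▸ hq.finrank_range_mulLeft_lt hp hqp hqne) hq hq0 rfl
      exact ⟨e, he, heq.trans hqp⟩

/-- Conjugation by `w` carries subprojections of `w * star w` to subprojections of `p` and can be
undone. -/
theorem IsMinimalProjection.mul_star {p w : F} (hp : IsMinimalProjection p)
    (hw : star w * w = p) : IsMinimalProjection (w * star w) := by
  have hwp := mul_eq_self_of_star_mul_self hp.1 hw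
  have hr := isStarProjection_mul_star hp.1 hw
  have hpp : p * p = p := hp.1.isIdempotentElem
  refine ⟨hr, fun h => hp.2.1 ?_, fun q hq hle => ?_⟩
  · rw [← hpp, ← hw, mul_assoc, ← mul_assoc w, h]; simp
  · have hqr := (hq.le_iff_mul_eq hr).1 hle
    have hrq : w * star w * q = q := by
      simpa [hq.isSelfAdjoint.star_eq] using congr(star $hqr)
    have hqq : q * q = q := hq.isIdempotentElem
    have hs : IsStarProjection (star w * q * w) := by
      refine ⟨?_, ?_⟩
      · rw [IsIdempotentElem]
        calc star w * q * w * (star w * q * w) = star w * (q * (w * star w)) * q * w := by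
              simp only [mul_assoc]
          _ = star w * q * w := by rw [hqr, mul_assoc (star w), hqq]
      · rw [IsSelfAdjoint]; simp [hq.isSelfAdjoint.star_eq, mul_assoc]
    have hback : w * (star w * q * w) * star w = q := by
      calc w * (star w * q * w) * star w = (w * star w * q) * (w * star w) := by
            simp only [mul_assoc]
        _ = q := by rw [hrq, hqr]
    rcases hp.2.2 _ hs ((hs.le_iff_mul_eq hp.1).2 (by rw [mul_assoc, hwp])) with h | h
    · left; rw [← hback, h]; simp
    · right; rw [← hback, h, hwp]

/-- For `x = q * y * e`, minimality makes `star x * x` and `x * star x` multiples of `e` and `q`;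
computing `x * star x * x` in two ways shows the factors agree, so a rescaling of `x` is a partial
isometry. -/
theorem IsMinimalProjection.mvnEquiv_of_ne_zero [FiniteDimensional ℂ F] {e q y : F}
    (he : IsMinimalProjection e) (hq : IsMinimalProjection q) (h : q * y * e ≠ 0) :
    MvNEquiv e q := by
  have hee : e * e = e := he.1.isIdempotentElem
  have hqq : q * q = q := hq.1.isIdempotentElem
  set x := q * y * e with hx
  have hxe : x * e = x := by rw [hx, mul_assoc, hee]
  have hqx : q * x = x := by rw [hx, ← mul_assoc, ← mul_assoc, hqq]
  have hxq : star x * q = star x := by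
    simpa [hq.1.isSelfAdjoint.star_eq] using congr(star $hqx)
  obtain ⟨c, hc0, hc⟩ := he.exists_eq_smul (IsSelfAdjoint.star_mul_self x)
    (by rw [mul_assoc, hxe])
  obtain ⟨d, -, hd⟩ := hq.exists_eq_smul (IsSelfAdjoint.mul_star_self x)
    (by rw [mul_assoc, hxq])
  have hc0 := hc0 (star_mul_self_nonneg x)
  have hcne : c ≠ 0 := by
    rintro rfl
    simp only [Complex.ofReal_zero, zero_smul, CStarRing.star_mul_self_eq_zero_iff] at hc
    exact h hc
  have hcd : (d : ℂ) = c := by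
    have h1 : x * (star x * x) = (x * star x) * x := (mul_assoc _ _ _).symm
    rw [hc, hd, mul_smul_comm, smul_mul_assoc, hxe, hqx] at h1
    exact (smul_left_injective ℂ h h1).symm
  have hs : (((√c)⁻¹ : ℝ) : ℂ) * (((√c)⁻¹ : ℝ) : ℂ) * (c : ℂ) = 1 := by
    rw [← Complex.ofReal_mul, ← Complex.ofReal_mul, ← mul_inv, Real.mul_self_sqrt hc0,
      inv_mul_cancel₀ hcne, Complex.ofReal_one]
  refine ⟨(((√c)⁻¹ : ℝ) : ℂ) • x, ?_, ?_⟩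
  · rw [star_smul, smul_mul_smul_comm, hc, smul_smul, Complex.star_def, Complex.conj_ofReal, hs,
      one_smul]
  · rw [star_smul, smul_mul_smul_comm, hd, hcd, smul_smul, Complex.star_def, Complex.conj_ofReal,
      hs, one_smul]

theorem IsMinimalProjection.exists_corner_eq_smul_of_mvnEquiv [FiniteDimensional ℂ F] {e q v : F}
    (he : IsMinimalProjection e) (h1 : star v * v = e) (h2 : v * star v = q) (y : F) :
    ∃ c : ℂ, q * y * e = c • v := by
  have hve := mul_eq_self_of_star_mul_self he.1 h1
  have hev : e * star v = star v := by
    simpa [he.1.isSelfAdjoint.star_eq] using congr(star $hve)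
  obtain ⟨c, hc⟩ := he.exists_corner_eq_smul (star v * y)
  refine ⟨c, ?_⟩
  rw [← mul_assoc, hev] at hc
  rw [← h2, mul_assoc v, mul_assoc v, hc, mul_smul_comm, hve]

omit [PartialOrder F] [StarOrderedRing F] in
theorem cstarOrthogonal_of_mul_eq_zero {p q : F} (hp : IsStarProjection p)
    (hq : IsStarProjection q) (h : p * q = 0) : CStarOrthogonal p q := by
  have hs : star p = p := hp.isSelfAdjoint
  have ht : star q = q := hq.isSelfAdjoint
  refine ⟨h, ?_, by rw [hs, h], by rw [ht, h]⟩
  simpa [hs, ht] using congr(star $h)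

omit [StarOrderedRing F] in
theorem isElementary_empty : IsElementary (∅ : Finset F) := by simp [IsElementary]

omit [StarOrderedRing F] in
theorem IsElementary.subset {Q R : Finset F} (hQ : IsElementary Q) (h : R ⊆ Q) :
    IsElementary R :=
  ⟨fun e he => hQ.1 e (h he), hQ.2.mono (by exact_mod_cast h)⟩

omit [StarOrderedRing F] in
theorem IsElementary.insert [DecidableEq F] {Q : Finset F} {e : F} (hQ : IsElementary Q)
    (he : IsMinimalProjection e) (h : ∀ q ∈ Q, e * q = 0) : IsElementary (insert e Q) := by
  refine ⟨fun x hx => ?_, ?_⟩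
  · rcases Finset.mem_insert.1 hx with rfl | hx
    exacts [he, hQ.1 _ hx]
  · rw [Finset.coe_insert, Set.pairwise_insert]
    refine ⟨hQ.2, fun q hq _ => ?_⟩
    have hq' := hQ.1 q (by simpa using hq)
    have := cstarOrthogonal_of_mul_eq_zero he.1 hq'.1 (h q (by simpa using hq))
    exact ⟨this, cstarOrthogonal_of_mul_eq_zero hq'.1 he.1 this.2.1⟩

omit [StarOrderedRing F] in
theorem IsElementary.mul_sum {Q : Finset F} (hQ : IsElementary Q) {e : F} (he : e ∈ Q) :
    e * ∑ q ∈ Q, q = e := by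
  rw [Finset.mul_sum, Finset.sum_eq_single_of_mem e he]
  · exact (hQ.1 e he).1.isIdempotentElem
  · intro q hq hne
    exact (hQ.2 (by simpa using he) (by simpa using hq) hne.symm).1

omit [StarOrderedRing F] in
theorem IsElementary.isStarProjection_sum {Q : Finset F} (hQ : IsElementary Q) :
    IsStarProjection (∑ q ∈ Q, q) := by
  refine ⟨?_, ?_⟩
  · rw [IsIdempotentElem, Finset.sum_mul]
    exact Finset.sum_congr rfl fun e he => hQ.mul_sum he
  · rw [IsSelfAdjoint, star_sum]
    exact Finset.sum_congr rfl fun e he => (hQ.1 e he).1.isSelfAdjoint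

theorem IsStarProjection.exists_isElementary_sum [FiniteDimensional ℂ F] {p : F}
    (hp : IsStarProjection p) :
    ∃ Q : Finset F, IsElementary Q ∧ ∑ q ∈ Q, q = p := by
  classical
  induction hn : Module.finrank ℂ (LinearMap.range (LinearMap.mulLeft ℂ p)) using
    Nat.strong_induction_on generalizing p with
  | _ n ih =>
    by_cases h0 : p = 0
    · exact ⟨∅, isElementary_empty, by simp [h0]⟩
    obtain ⟨e, he, hle⟩ := hp.exists_minimal_le h0
    have hep := (he.1.le_iff_mul_eq hp).1 hle
    have hpe : p * e = e := by
      simpa [hp.isSelfAdjoint.star_eq, he.1.isSelfAdjoint.star_eq] using congr(star $hep)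
    have hsub : IsStarProjection (p - e) := he.1.sub_of_mul_eq_left hp hep
    obtain ⟨Q, hQ, hsum⟩ := ih _ (hn ▸ hsub.finrank_range_mulLeft_lt hp
      ((hsub.le_iff_mul_eq hp).2 (by rw [sub_mul, hp.isIdempotentElem.eq, hep]))
      (by simpa using he.2.1)) hsub rfl
    have hz (q : F) (hq : q ∈ Q) : e * q = 0 := by
      have h1 := hQ.mul_sum hq
      rw [hsum] at h1
      have h2 : (p - e) * q = q := by
        simpa [hsub.isSelfAdjoint.star_eq, hp.isSelfAdjoint.star_eq,
          (hQ.1 q hq).1.isSelfAdjoint.star_eq, he.1.isSelfAdjoint.star_eq] using congr(star $h1)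
      rw [← h2, ← mul_assoc, mul_sub, hep, he.1.isIdempotentElem.eq]; simp
    have hnot : e ∉ Q := fun h => he.2.1 (by
      rw [← he.1.isIdempotentElem.eq]; exact hz e h)
    exact ⟨insert e Q, hQ.insert he hz, by rw [Finset.sum_insert hnot, hsum]; abel⟩

end Projections

theorem exists_max_card {α : Type*} {P : Finset α → Prop} (h0 : P ∅) {m : ℕ}
    (hm : ∀ Q, P Q → Q.card ≤ m) : ∃ Q, P Q ∧ ∀ R, P R → R.card ≤ Q.card := by
  classical
  let p : ℕ → Prop := fun k => ∃ Q, P Q ∧ Q.card = k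
  obtain ⟨Q, hQ, hc⟩ : p (Nat.findGreatest p m) :=
    Nat.findGreatest_spec (Nat.zero_le m) ⟨∅, h0, rfl⟩
  exact ⟨Q, hQ, fun R hR => hc ▸ Nat.le_findGreatest (hm R hR) ⟨R, hR, rfl⟩⟩

/-! ### Positive functionals on finite-dimensional C⋆-algebras -/

section Functionals

variable {F : Type*} [CStarAlgebra F] [PartialOrder F] [StarOrderedRing F]

omit [StarOrderedRing F] in
theorem IsElementary.notMem_of_mul_eq_zero {Q : Finset F} {e : F} (he : IsMinimalProjection e)
    (h : ∀ q ∈ Q, e * q = 0) : e ∉ Q := fun hm =>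
  he.2.1 (by rw [← he.1.isIdempotentElem.eq]; exact h e hm)

/-- Rotating two equivalent orthogonal minimal projections by `π / 4` spreads the mass of a
positive functional over both. -/
theorem IsMinimalProjection.exists_rotation {g : F →ₗ[ℝ] ℝ} (hg : ∀ y, 0 ≤ y → 0 ≤ g y)
    {p q : F} (hp : IsMinimalProjection p) (hq : IsMinimalProjection q) (hpq : p * q = 0)
    (hequiv : MvNEquiv p q) (hgp : g p = 0) (hgq : 0 < g q) :
    ∃ p' q' : F, IsMinimalProjection p' ∧ IsMinimalProjection q' ∧ p' * q' = 0 ∧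
      0 < g p' ∧ 0 < g q' ∧ ∀ r, p * r = 0 → q * r = 0 → p' * r = 0 ∧ q' * r = 0 := by
  obtain ⟨v, h1, h2⟩ := hequiv
  have hps : star p = p := hp.1.isSelfAdjoint
  have hqs : star q = q := hq.1.isSelfAdjoint
  have hpp : p * p = p := hp.1.isIdempotentElem
  have hvp : v * p = v := mul_eq_self_of_star_mul_self hp.1 h1
  have hvq : star v * q = star v := mul_eq_self_of_star_mul_self hq.1 (by simpa using h2)
  have hpv : p * star v = star v := by simpa [hps] using congr(star $hvp)
  have hqv : q * v = v := by simpa [hqs] using congr(star $hvq)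
  have hpv0 : p * v = 0 := by rw [← hqv, ← mul_assoc, hpq, zero_mul]
  have hvp0 : star v * p = 0 := by simpa [hps] using congr(star $hpv0)
  -- Since `g p = 0`, the mass of `(t p + v)(t p + v)⋆` is affine in `t`; being nonnegative for all
  -- `t`, it has slope zero.
  have hcross : g (v + star v) = 0 := by
    have key (t : ℝ) : 0 ≤ t * g (v + star v) + g q := by
      have h := hg _ (mul_star_self_nonneg (t • p + v))
      have : (t • p + v) * star (t • p + v) = (t * t) • p + t • (v + star v) + q := by
        simp only [star_add, star_smul, star_trivial, hps, add_mul, mul_add,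
          hpp, smul_mul_assoc, mul_smul_comm, hpv, hvp, h2]
        module
      rw [this, map_add, map_add, map_smul, map_smul, hgp] at h
      simpa only [smul_eq_mul, mul_zero, zero_add] using h
    by_contra hne
    have := key (-(g q + 1) / g (v + star v))
    rw [div_mul_cancel₀ _ hne] at this
    linarith
  have hr : (√2)⁻¹ * (√2)⁻¹ = (2 : ℝ)⁻¹ := by
    rw [← mul_inv, Real.mul_self_sqrt (by norm_num)]
  -- This is `w * star w` for `w = (p + s v) / √2`. The signs `s = ±1` give the two rotated
  -- projections, each of mass `g q / 2` because the cross term vanishes.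
  have min (s : ℝ) (hs : s * s = 1) :
      IsMinimalProjection ((2 : ℝ)⁻¹ • (p + q + s • (v + star v))) := by
    have := hp.mul_star (w := (√2)⁻¹ • (p + s • v)) (by
      simp only [star_add, star_smul, star_trivial, hps, add_mul, mul_add,
          hpp, smul_mul_assoc, mul_smul_comm, hpv0, hvp0, h1]
      linear_combination (norm := module) ((1 + s * s) * hr + (2 : ℝ)⁻¹ * hs) • p)
    convert this using 1
    simp only [star_add, star_smul, star_trivial, hps, add_mul, mul_add,
          hpp, smul_mul_assoc, mul_smul_comm, hpv, hvp, h2]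
    linear_combination (norm := module) -(hr • (p + s • v + s • star v + (s * s) • q)) - ((2 : ℝ)⁻¹ * hs) • q
  have vv : v * v = 0 := by
    nth_rw 1 [← hvp]
    rw [mul_assoc, hpv0, mul_zero]
  have svv : star v * star v = 0 := by simpa using congr(star $vv)
  have hqp : q * p = 0 := by simpa [hps, hqs] using congr(star $hpq)
  have hvq0 : v * q = 0 := by rw [← hvp, mul_assoc, hpq, mul_zero]
  have hqv0 : q * star v = 0 := by simpa [hqs] using congr(star $hvq0)
  refine ⟨_, _, min 1 (by norm_num), min (-1) (by norm_num), ?_, ?_, ?_, ?_⟩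
  · rw [smul_mul_smul_comm]
    simp only [one_smul, neg_smul, add_mul, mul_add, mul_neg, hpp, hq.1.isIdempotentElem.eq,
      hpq, hqp, hvp, hpv, hvq, hqv, hpv0, hvp0, hvq0, hqv0, vv, svv, h1, h2]
    rw [show (2 : ℝ)⁻¹ * 2⁻¹ = 4⁻¹ by norm_num, smul_eq_zero]
    right; abel
  · simp only [map_smul, map_add g (p + q), map_add g p, hcross, hgp, smul_eq_mul]
    linarith
  · simp only [map_smul, map_add g (p + q), map_add g p, hcross, hgp, smul_eq_mul]
    linarith
  · intro r hpr hqr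
    have e1 : v * r = 0 := by rw [← hvp, mul_assoc, hpr, mul_zero]
    have e2 : star v * r = 0 := by rw [← hvq, mul_assoc, hqr, mul_zero]
    simp [add_mul, hpr, hqr, e1, e2]

/-- Take `Q` of maximal size among elementary sets of positive mass. A minimal projection orthogonal
to `Q` has mass zero; if it were equivalent to a member of `Q`, rotating the two would give a larger
set. So no corner links `∑ q` to its complement, and `∑ q` is central. -/
theorem exists_central_support [FiniteDimensional ℂ F] {g : F →ₗ[ℝ] ℝ}
    (hg : ∀ y, 0 ≤ y → 0 ≤ g y) {m : ℕ}
    (hm : ∀ Q : Finset F, IsElementary Q → (∀ q ∈ Q, 0 < g q) → Q.card ≤ m) :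
    ∃ Q : Finset F, IsElementary Q ∧ Q.card ≤ m ∧ (∀ y, (∑ q ∈ Q, q) * y = y * ∑ q ∈ Q, q) ∧
      g (1 - ∑ q ∈ Q, q) = 0 := by
  classical
  obtain ⟨Q, ⟨hQ, hQg⟩, hmax'⟩ := exists_max_card
    (P := fun Q : Finset F => IsElementary Q ∧ ∀ q ∈ Q, 0 < g q) ⟨isElementary_empty, by simp⟩
    (fun Q hQ => hm Q hQ.1 hQ.2)
  have hmax (R : Finset F) (hR : IsElementary R) (hRg : ∀ q ∈ R, 0 < g q) :
      R.card ≤ Q.card := hmax' R ⟨hR, hRg⟩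
  set z := ∑ q ∈ Q, q with hz
  have hzp : IsStarProjection z := hQ.isStarProjection_sum
  have hzq (q : F) (hq : q ∈ Q) : z * q = q := by
    have h := congrArg star (hQ.mul_sum hq)
    rwa [star_mul, ← hz, hzp.isSelfAdjoint.star_eq, (hQ.1 q hq).1.isSelfAdjoint.star_eq] at h
  have hbig (R : Finset F) (e : F) (hR : IsElementary R) (hRg : ∀ q ∈ R, 0 < g q)
      (hRc : Q.card ≤ R.card) (he : IsMinimalProjection e) (heg : 0 < g e)
      (h0 : ∀ q ∈ R, e * q = 0) : False := by
    have := hmax (insert e R) (hR.insert he h0) (by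
      intro x hx
      rcases Finset.mem_insert.1 hx with rfl | hx
      exacts [heg, hRg _ hx])
    rw [Finset.card_insert_of_notMem (IsElementary.notMem_of_mul_eq_zero he h0)] at this
    omega
  have key (p : F) (hp : IsMinimalProjection p) (hpz : p * z = 0) :
      g p = 0 ∧ ∀ q ∈ Q, ∀ y, q * y * p = 0 := by
    have hpq (q : F) (hq : q ∈ Q) : p * q = 0 := by
      rw [← hzq q hq, ← mul_assoc, hpz, zero_mul]
    have hgp : g p = 0 := by
      by_contra hne
      exact hbig Q p hQ hQg le_rfl hp (lt_of_le_of_ne (hg p hp.1.nonneg) (Ne.symm hne)) hpq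
    refine ⟨hgp, fun q hq y => ?_⟩
    by_contra hne
    obtain ⟨p', q', hp', hq', hpq', hgp', hgq', hrot⟩ := hp.exists_rotation hg (hQ.1 q hq)
      (hpq q hq) (hp.mvnEquiv_of_ne_zero (hQ.1 q hq) hne) hgp (hQg q hq)
    have horth (r : F) (hr : r ∈ Q.erase q) : p' * r = 0 ∧ q' * r = 0 := by
      rw [Finset.mem_erase] at hr
      exact hrot r (hpq r hr.2) (hQ.2 (by simpa using hq) (by simpa using hr.2) hr.1.symm).1
    have hR : IsElementary (Q.erase q) := hQ.subset (Finset.erase_subset _ _)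
    refine hbig (insert q' (Q.erase q)) p' (hR.insert hq' fun r hr => (horth r hr).2) ?_ ?_ hp'
      hgp' ?_
    · intro x hx
      rcases Finset.mem_insert.1 hx with rfl | hx
      exacts [hgq', hQg _ (Finset.mem_of_mem_erase hx)]
    · rw [Finset.card_insert_of_notMem
        (IsElementary.notMem_of_mul_eq_zero hq' fun r hr => (horth r hr).2),
        Finset.card_erase_add_one hq]
    · intro x hx
      rcases Finset.mem_insert.1 hx with rfl | hx
      exacts [hpq', (horth _ hx).1]
  obtain ⟨R, hR, hsum⟩ := hzp.one_sub.exists_isElementary_sum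
  have hRz (r : F) (hr : r ∈ R) : r * z = 0 := by
    have := hR.mul_sum hr
    rw [hsum, mul_sub, mul_one] at this
    simpa using this
  refine ⟨Q, hQ, hm Q hQ hQg, ?_, ?_⟩
  · have hcorner (y : F) : z * y * (1 - z) = 0 := by
      rw [← hsum, hz, Finset.sum_mul, Finset.sum_mul]
      refine Finset.sum_eq_zero fun q hq => ?_
      rw [Finset.mul_sum]
      exact Finset.sum_eq_zero fun r hr => (key r (hR.1 r hr) (hRz r hr)).2 q hq y
    intro y
    have h1 := hcorner y
    -- The adjoint of the corner identity kills the opposite corner.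
    have h2 := congr(star $(hcorner (star y)))
    simp only [star_mul, star_sub, star_one, hzp.isSelfAdjoint.star_eq, star_star, star_zero] at h2
    rw [mul_sub, mul_one, sub_eq_zero] at h1
    rw [sub_mul, one_mul, sub_eq_zero, ← mul_assoc] at h2
    rw [h1, h2]
  · rw [← hsum, map_sum]
    exact Finset.sum_eq_zero fun r hr => (key r (hR.1 r hr) (hRz r hr)).1

/-- Centrality of `z = ∑ q` and minimality of `e` force `z * e = e`, so `Fe` is the sum of the
corners `qFe`. Such a corner is zero unless `q` is equivalent to `e`, and then it is at most a line.
The dimension of `Fe` plays the role of the size of the matrix block of `e`. -/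
theorem finrank_range_mulRight_le_card [FiniteDimensional ℂ F] {Q : Finset F}
    (hQ : IsElementary Q) (hz : ∀ y, (∑ q ∈ Q, q) * y = y * ∑ q ∈ Q, q) {e q : F}
    (he : IsMinimalProjection e) (heq : MvNEquiv e q) (hzq : (∑ q ∈ Q, q) * q ≠ 0)
    [DecidablePred (MvNEquiv e)] :
    Module.finrank ℂ (LinearMap.range (LinearMap.mulRight ℂ e)) ≤
      (Q.filter (MvNEquiv e)).card := by
  classical
  set z := ∑ q ∈ Q, q with hzdef
  have hzp : IsStarProjection z := hQ.isStarProjection_sum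
  have hze : z * e = e := by
    have hproj : IsStarProjection (z * e) := hzp.mul he.1 (hz e)
    rcases he.2.2 _ hproj ((hproj.le_iff_mul_eq he.1).2
      (by rw [mul_assoc, he.1.isIdempotentElem.eq])) with h | h
    · obtain ⟨v, h1, h2⟩ := heq
      refine absurd ?_ hzq
      rw [← h2, ← mul_eq_self_of_star_mul_self he.1 h1, ← mul_assoc, ← mul_assoc, hz v,
        mul_assoc v, h]
      simp
    · exact h
  have hv : ∀ q : F, ∃ v : F, MvNEquiv e q → star v * v = e ∧ v * star v = q := fun q => by
    by_cases h : MvNEquiv e q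
    · obtain ⟨v, hv⟩ := h
      exact ⟨v, fun _ => hv⟩
    · exact ⟨0, fun h' => absurd h' h⟩
  choose v hv using hv
  have hle : LinearMap.range (LinearMap.mulRight ℂ e) ≤
      Submodule.span ℂ (((Q.filter (MvNEquiv e)).image v : Finset F) : Set F) := by
    rintro _ ⟨y, rfl⟩
    have : y * e = ∑ q ∈ Q, q * y * e := by
      rw [← Finset.sum_mul, ← Finset.sum_mul, ← hzdef, hz y, mul_assoc, hze]
    rw [LinearMap.mulRight_apply, this]
    refine Submodule.sum_mem _ fun q hq => ?_
    by_cases h0 : q * y * e = 0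
    · rw [h0]; exact Submodule.zero_mem _
    · have heq' := he.mvnEquiv_of_ne_zero (hQ.1 q hq) h0
      obtain ⟨c, hc⟩ := he.exists_corner_eq_smul_of_mvnEquiv (hv q heq').1 (hv q heq').2 y
      rw [hc]
      exact Submodule.smul_mem _ _ (Submodule.subset_span (by
        simpa using ⟨q, ⟨hq, heq'⟩, rfl⟩))
  calc _ ≤ _ := Submodule.finrank_mono hle
    _ ≤ _ := finrank_span_finset_le_card _
    _ ≤ _ := Finset.card_image_le

theorem sum_finrank_range_mulRight_le_card [FiniteDimensional ℂ F] {Q : Finset F}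
    (hQ : IsElementary Q) (hz : ∀ y, (∑ q ∈ Q, q) * y = y * ∑ q ∈ Q, q) {S : Finset F}
    (hS : ∀ e ∈ S, IsMinimalProjection e)
    (hne : ∀ e ∈ S, ∀ f ∈ S, MvNEquiv e f → e = f)
    (h : ∀ e ∈ S, ∃ q, MvNEquiv e q ∧ (∑ q ∈ Q, q) * q ≠ 0) :
    ∑ e ∈ S, Module.finrank ℂ (LinearMap.range (LinearMap.mulRight ℂ e)) ≤ Q.card := by
  classical
  calc _ ≤ ∑ e ∈ S, (Q.filter (MvNEquiv e)).card := by
        refine Finset.sum_le_sum fun e he => ?_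
        obtain ⟨q, hq, hzq⟩ := h e he
        exact finrank_range_mulRight_le_card hQ hz (hS e he) hq hzq
    _ = (S.biUnion fun e => Q.filter (MvNEquiv e)).card := by
        refine (Finset.card_biUnion fun e he f hf hef => ?_).symm
        refine Finset.disjoint_left.2 ?_
        intro q hq hq'
        rw [Finset.mem_filter] at hq hq'
        exact hef (hne e he f hf (hq.2.trans (hS e he).1 (hS f hf).1 hq'.2.symm))
    _ ≤ Q.card := Finset.card_le_card (Finset.biUnion_subset.2 fun e _ => Finset.filter_subset _ _)

omit [StarOrderedRing F] in
theorem IsMinimalProjection.norm_eq_one {e : F} (he : IsMinimalProjection e) : ‖e‖ = 1 := by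
  have h : ‖star e * e‖ = ‖e‖ * ‖e‖ := CStarRing.norm_star_mul_self
  rw [he.1.isSelfAdjoint.star_eq, he.1.isIdempotentElem.eq] at h
  have : ‖e‖ ≠ 0 := norm_ne_zero_iff.2 he.2.1
  exact (mul_right_cancel₀ this (by rw [one_mul]; exact h)).symm

/-- The Gram matrix of the `ξ s`, with entries in `e F e = ℂ e`, is strictly diagonally dominant,
hence invertible; so these elements of `Fe` are linearly independent. -/
theorem card_le_finrank_range_mulRight [FiniteDimensional ℂ F] {ι : Type*} [Fintype ι] {e : F}
    (he : IsMinimalProjection e) (ξ : ι → F) (hξ : ∀ s, star (ξ s) * ξ s = e) {δ : ℝ}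
    (hδ0 : 0 ≤ δ) (hδ : Fintype.card ι * δ < 1) (h : ∀ s t, s ≠ t → ‖star (ξ s) * ξ t‖ ≤ δ) :
    Fintype.card ι ≤ Module.finrank ℂ (LinearMap.range (LinearMap.mulRight ℂ e)) := by
  classical
  have hr (s : ι) : ξ s * e = ξ s := mul_eq_self_of_star_mul_self he.1 (hξ s)
  have hl (s : ι) : e * star (ξ s) = star (ξ s) := by
    simpa [he.1.isSelfAdjoint.star_eq] using congr(star $(hr s))
  have hμ (s t : ι) : ∃ c : ℂ, star (ξ s) * ξ t = c • e := by
    obtain ⟨c, hc⟩ := he.exists_corner_eq_smul (star (ξ s) * ξ t)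
    refine ⟨c, ?_⟩
    rwa [← mul_assoc, hl, mul_assoc, hr] at hc
  choose μ hμ using hμ
  have hnorm (s t : ι) : ‖μ s t‖ = ‖star (ξ s) * ξ t‖ := by
    rw [hμ, norm_smul, he.norm_eq_one, mul_one]
  have hdet : (Matrix.of μ).det ≠ 0 := by
    refine det_ne_zero_of_sum_row_lt_diag fun k => ?_
    simp only [Matrix.of_apply]
    have hk : ‖μ k k‖ = 1 := by rw [hnorm, hξ, he.norm_eq_one]
    rw [hk]
    calc ∑ j ∈ Finset.univ.erase k, ‖μ k j‖ ≤ ∑ j ∈ Finset.univ.erase k, δ :=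
          Finset.sum_le_sum fun j hj => by
            rw [hnorm]; exact h k j (Finset.ne_of_mem_erase hj).symm
      _ ≤ ∑ j : ι, δ := Finset.sum_le_sum_of_subset_of_nonneg (Finset.erase_subset _ _)
          fun _ _ _ => hδ0
      _ < 1 := by simpa using hδ
  have hind : LinearIndependent ℂ ξ := by
    rw [Fintype.linearIndependent_iff]
    intro α hα
    have : (Matrix.of μ).mulVec α = 0 := by
      ext s
      have h1 : (∑ t, μ s t * α t) • e = 0 := by
        have := congr(star (ξ s) * $hα)
        rw [Finset.mul_sum, mul_zero] at this
        rw [← this, Finset.sum_smul]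
        refine Finset.sum_congr rfl fun t _ => ?_
        rw [mul_smul_comm, hμ, smul_smul, mul_comm]
      simpa [Matrix.mulVec, dotProduct, he.2.1] using h1
    exact congrFun (Matrix.eq_zero_of_mulVec_eq_zero hdet this)
  rw [← finrank_span_eq_card hind]
  refine Submodule.finrank_mono (Submodule.span_le.2 ?_)
  rintro _ ⟨s, rfl⟩
  exact ⟨ξ s, hr s⟩

/-- Chebyshev's inequality: the spectral projection `p` of `C` below `η` satisfies `η (1 - p) ≤ C`,
so `g p > 0`, and some minimal summand of `p` has positive mass. -/
theorem exists_minimalProjection_norm_le [FiniteDimensional ℂ F] {g : F →ₗ[ℝ] ℝ}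
    (hg : ∀ y, 0 ≤ y → 0 ≤ g y) {C : F} (hC : 0 ≤ C) {η : ℝ} (hη : 0 < η)
    (h : g C < η * g 1) : ∃ q : F, IsMinimalProjection q ∧ 0 < g q ∧ ‖q * C * q‖ ≤ η := by
  have hc (f : ℝ → ℝ) : ContinuousOn f (spectrum ℝ C) := (spectrum_real_finite C).continuousOn f
  have hsa : IsSelfAdjoint C := .of_nonneg hC
  set p := cfc ((Set.Iio η).indicator (1 : ℝ → ℝ)) C with hp
  have hpp : IsStarProjection p := isStarProjection_cfc_indicator C _
  have h1 : η • (1 - p) ≤ C := by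
    conv_rhs => rw [← cfc_id ℝ C]
    rw [hp, ← cfc_one ℝ C, ← cfc_sub _ _ C (hc _) (hc _), ← cfc_smul η _ C (hc _)]
    refine cfc_mono (fun x hx => ?_) (hc _) (hc _)
    have hx0 := spectrum_nonneg_of_nonneg hC hx
    by_cases hxη : x < η
    · simpa [hxη] using hx0
    · simpa [hxη] using not_lt.1 hxη
  have hgp : 0 < g p := by
    have := hg _ (sub_nonneg.2 h1)
    rw [map_sub, map_smul, map_sub, smul_eq_mul] at this
    have h2 : 0 < η * g p := by linarith
    exact pos_of_mul_pos_right h2 hη.le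
  have hCp : ‖C * p‖ ≤ η := by
    have : C * p = cfc (fun x => x * (Set.Iio η).indicator (1 : ℝ → ℝ) x) C := by
      rw [cfc_mul (fun x => x) _ C (hc _) (hc _), cfc_id' ℝ C]
    rw [this]
    refine norm_cfc_le hη.le fun x hx => ?_
    have hx0 := spectrum_nonneg_of_nonneg hC hx
    by_cases hxη : x < η
    · simp [hxη, abs_of_nonneg hx0, hxη.le]
    · simp [hxη, hη.le]
  obtain ⟨R, hR, hsum⟩ := hpp.exists_isElementary_sum
  obtain ⟨r, hr, hgr⟩ : ∃ r ∈ R, 0 < g r := by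
    rw [← hsum, map_sum] at hgp
    by_contra! hcon
    exact absurd hgp (not_lt.2 (Finset.sum_nonpos hcon))
  have hrm := hR.1 r hr
  refine ⟨r, hrm, hgr, ?_⟩
  have hrp : r * p = r := hsum ▸ hR.mul_sum hr
  have hpr : p * r = r := by
    simpa [hpp.isSelfAdjoint.star_eq, hrm.1.isSelfAdjoint.star_eq] using congr(star $hrp)
  calc ‖r * C * r‖ = ‖r * (C * p) * r‖ := by
        rw [mul_assoc, mul_assoc r (C * p), mul_assoc C p, hpr]
    _ ≤ ‖r‖ * ‖C * p‖ * ‖r‖ := (norm_mul_le _ _).trans (by gcongr; exact norm_mul_le _ _)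
    _ ≤ η := by rw [hrm.norm_eq_one]; simpa using hCp

end Functionals

/-! ### Covering dimension: finite refinements and the sum theorem -/

section Covering

variable {X : Type u}

theorem familyOrderLE_iff {κ : Type*} {V : κ → Set X} {n : ℤ} {m : ℕ} (hm : (m : ℤ) = n + 1) :
    FamilyOrderLE V n ↔ ∀ x, ∀ s : Finset κ, (∀ i ∈ s, x ∈ V i) → s.card ≤ m := by
  constructor
  · intro h x s hs
    by_contra! hlt
    obtain ⟨t, hts, ht⟩ := Finset.exists_subset_card_eq (Nat.succ_le_of_lt hlt)
    have := h t (by rw [ht]; push_cast; omega)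
    have hx : x ∈ ⋂ i ∈ t, V i := by
      simp only [Set.mem_iInter]
      exact fun i hi => hs i (hts hi)
    rw [this] at hx
    exact hx
  · intro h s hs
    rw [Set.eq_empty_iff_forall_notMem]
    intro x hx
    simp only [Set.mem_iInter] at hx
    have := h x s hx
    omega

/-- Uniting the `V j` assigned to the same `U i` cannot raise multiplicity: distinct groups
containing `x` have distinct members containing `x`. -/
theorem exists_grouping {κ ι : Type*} [TopologicalSpace X] {V : κ → Set X} {U : ι → Set X}
    (hV : ∀ j, IsOpen (V j)) (hVU : ∀ j, ∃ i, V j ⊆ U i) {m : ℕ}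
    (hm : ∀ x, ∀ s : Finset κ, (∀ i ∈ s, x ∈ V i) → s.card ≤ m) :
    ∃ W : ι → Set X, (∀ i, IsOpen (W i)) ∧ (∀ i, W i ⊆ U i) ∧ (∀ j, V j ⊆ ⋃ i, W i) ∧
      ∀ x, ∀ s : Finset ι, (∀ i ∈ s, x ∈ W i) → s.card ≤ m := by
  classical
  choose c hc using hVU
  refine ⟨fun i => ⋃ (j) (_ : c j = i), V j, fun i => isOpen_iUnion fun j => isOpen_iUnion
    fun _ => hV j, fun i => Set.iUnion₂_subset fun j hj => hj ▸ hc j, fun j x hx => ?_,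
    fun x s hs => ?_⟩
  · exact Set.mem_iUnion.2 ⟨c j, Set.mem_iUnion₂.2 ⟨j, rfl, hx⟩⟩
  · have : ∀ i ∈ s, ∃ j, c j = i ∧ x ∈ V j := fun i hi => by simpa using hs i hi
    rcases s.eq_empty_or_nonempty with rfl | ⟨i₀, hi₀⟩
    · simp
    have : Nonempty κ := ⟨(this i₀ hi₀).choose⟩
    choose! d hd using ‹∀ i ∈ s, ∃ j, c j = i ∧ x ∈ V j›
    rw [← Finset.card_image_of_injOn (s := s) (f := d)]
    · refine hm x _ fun j hj => ?_
      obtain ⟨i, hi, rfl⟩ := Finset.mem_image.1 hj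
      exact (hd i hi).2
    · intro i hi i' hi' h
      rw [← (hd i hi).1, ← (hd i' hi').1, h]

variable [TopologicalSpace X]

theorem CoveringDimLE.exists_finite_refinement {n : ℤ} {m : ℕ} (hm : (m : ℤ) = n + 1)
    (h : CoveringDimLE X n) {k : ℕ} {U : Fin k → Set X} (hU : ∀ i, IsOpen (U i))
    (hcov : ⋃ i, U i = Set.univ) :
    ∃ W : Fin k → Set X, (∀ i, IsOpen (W i)) ∧ (∀ i, W i ⊆ U i) ∧ ⋃ i, W i = Set.univ ∧
      ∀ x, ∀ s : Finset (Fin k), (∀ i ∈ s, x ∈ W i) → s.card ≤ m := by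
  obtain ⟨κ, V, hV, hVU, hord⟩ := h k (fun i => ⟨U i, hU i⟩) (by
    rw [IsOpenCover]; ext x; simpa using (Set.ext_iff.1 hcov x).2 trivial)
  obtain ⟨W, hW, hWU, hVW, hW'⟩ := exists_grouping (fun j => (V j).isOpen) hVU
    ((familyOrderLE_iff hm).1 hord)
  refine ⟨W, hW, hWU, Set.eq_univ_of_forall fun x => ?_, hW'⟩
  obtain ⟨j, hj⟩ := hV.exists_mem x
  exact hVW j hj

theorem CoveringDimLE.of_finite_refinement {n : ℤ} {m : ℕ} (hm : (m : ℤ) = n + 1)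
    (h : ∀ (k : ℕ) (U : Fin k → Set X), (∀ i, IsOpen (U i)) → ⋃ i, U i = Set.univ →
      ∃ W : Fin k → Set X, (∀ i, IsOpen (W i)) ∧ (∀ i, W i ⊆ U i) ∧ ⋃ i, W i = Set.univ ∧
      ∀ x, ∀ s : Finset (Fin k), (∀ i ∈ s, x ∈ W i) → s.card ≤ m) : CoveringDimLE X n := by
  intro k U hU
  obtain ⟨W, hW, hWU, hcov, hord⟩ := h k (fun i => U i) (fun i => (U i).isOpen) (by
    simpa using hU.iSup_set_eq_univ)
  refine ⟨ULift (Fin k), fun i => ⟨W i.down, hW _⟩, ?_, fun j => ⟨j.down, hWU _⟩,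
    (familyOrderLE_iff hm).2 fun x s hs => ?_⟩
  · rw [IsOpenCover]
    ext x
    simpa using (Set.ext_iff.1 hcov x).2 trivial
  · rw [← Finset.card_map Equiv.ulift.toEmbedding]
    exact hord x _ (by simpa using hs)

/-- A finite family of closed sets in a normal space can be swollen to open sets without increasing
its order. -/
theorem exists_isOpen_swelling [NormalSpace X] {ι : Type*} [Finite ι] {C U : ι → Set X} {m : ℕ}
    (hC : ∀ i, IsClosed (C i)) (hU : ∀ i, IsOpen (U i)) (hCU : ∀ i, C i ⊆ U i)
    (hord : ∀ x, ∀ s : Finset ι, (∀ i ∈ s, x ∈ C i) → s.card ≤ m) :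
    ∃ W : ι → Set X, (∀ i, IsOpen (W i)) ∧ (∀ i, W i ⊆ U i) ∧ (∀ i, C i ⊆ W i) ∧
      ∀ x, ∀ s : Finset ι, (∀ i ∈ s, x ∈ W i) → s.card ≤ m := by
  classical
  have key (s : Finset ι) : ∃ O : ι → Set X, (∀ i, IsOpen (O i)) ∧ (∀ i, C i ⊆ O i) ∧
      (m < s.card → ∀ x, ¬ ∀ i ∈ s, x ∈ O i) := by
    by_cases hs : m < s.card
    swap
    · exact ⟨fun _ => Set.univ, fun _ => isOpen_univ, fun _ => Set.subset_univ _,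
        fun h => absurd h hs⟩
    -- More than `m` of the `C i` have no common point, so their complements cover `X`. Complements
    -- of the closures of a shrinking are open neighbourhoods of the `C i`, still without a common
    -- point.
    obtain ⟨v, hv, hvo, hvu⟩ := exists_iUnion_eq_closure_subset
      (u := fun i => if i ∈ s then (C i)ᶜ else ∅)
      (fun i => by split_ifs; exacts [(hC i).isOpen_compl, isOpen_empty])
      (fun x => Set.toFinite _) (by
        refine Set.eq_univ_of_forall fun x => ?_
        by_contra hx
        simp only [Set.mem_iUnion, not_exists] at hx
        refine absurd (hord x s fun i hi => ?_) (not_le.2 hs)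
        simpa [hi] using hx i)
    refine ⟨fun i => (closure (v i))ᶜ, fun i => isClosed_closure.isOpen_compl, fun i x hx hxv => ?_,
      fun _ x hx => ?_⟩
    · have := hvu i hxv
      by_cases hi : i ∈ s
      · simp only [hi, if_true] at this
        exact this hx
      · simp [hi] at this
    · obtain ⟨i, hi⟩ := Set.iUnion_eq_univ_iff.1 hv x
      have h1 := hvu i (subset_closure hi)
      by_cases his : i ∈ s
      · exact hx i his (subset_closure hi)
      · simp [his] at h1
  choose O hO hCO hOs using key
  have : Finite (Finset ι) := by have := Fintype.ofFinite ι; infer_instance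
  refine ⟨fun i => U i ∩ ⋂ s, O s i, fun i => (hU i).inter (isOpen_iInter_of_finite fun s => hO s i),
    fun i => Set.inter_subset_left, fun i => Set.subset_inter (hCU i)
      (Set.subset_iInter fun s => hCO s i), fun x s hs => ?_⟩
  by_contra! hlt
  exact hOs s hlt x fun i hi => Set.mem_iInter.1 (hs i hi).2 s

/-- Sum theorem: a bound for the covering dimension on compact subsets of a `σ`-compact normal
space holds on the whole space. -/
theorem exists_refinement_of_compact [NormalSpace X] [T2Space X] [SigmaCompactSpace X] {m : ℕ}
    (h : ∀ (K : Set X), IsCompact K → ∀ (k : ℕ) (U : Fin k → Set X), (∀ i, IsOpen (U i)) →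
      K ⊆ ⋃ i, U i → ∃ W : Fin k → Set X, (∀ i, IsOpen (W i)) ∧ (∀ i, W i ⊆ U i) ∧ K ⊆ ⋃ i, W i ∧
      ∀ x, ∀ s : Finset (Fin k), (∀ i ∈ s, x ∈ W i) → s.card ≤ m)
    (k : ℕ) (U : Fin k → Set X) (hU : ∀ i, IsOpen (U i)) (hcov : ⋃ i, U i = Set.univ) :
    ∃ W : Fin k → Set X, (∀ i, IsOpen (W i)) ∧ (∀ i, W i ⊆ U i) ∧ ⋃ i, W i = Set.univ ∧
      ∀ x, ∀ s : Finset (Fin k), (∀ i ∈ s, x ∈ W i) → s.card ≤ m := by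
  let S := {U : Fin k → Set X // (∀ i, IsOpen (U i)) ∧ ⋃ i, U i = Set.univ}
  have step (j : ℕ) (U : S) : ∃ U' : S, (∀ i, closure (U'.1 i) ⊆ U.1 i) ∧
      ∀ x ∈ compactCovering X j, ∀ s : Finset (Fin k), (∀ i ∈ s, x ∈ closure (U'.1 i)) →
        s.card ≤ m := by
    have hK := isCompact_compactCovering X j
    obtain ⟨W, hW, hWU, hKW, hord⟩ := h _ hK k U.1 U.2.1 (by rw [U.2.2]; exact Set.subset_univ _)
    -- The cover is altered to `W` on the `j`-th compact set and left as it was elsewhere.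
    obtain ⟨v, hv, hvo, hvu⟩ := exists_iUnion_eq_closure_subset
      (u := fun i => W i ∪ (U.1 i \ compactCovering X j))
      (fun i => (hW i).union ((U.2.1 i).sdiff hK.isClosed)) (fun x => Set.toFinite _) (by
        refine Set.eq_univ_of_forall fun x => ?_
        by_cases hx : x ∈ compactCovering X j
        · obtain ⟨i, hi⟩ := Set.mem_iUnion.1 (hKW hx)
          exact Set.mem_iUnion.2 ⟨i, Or.inl hi⟩
        · obtain ⟨i, hi⟩ := Set.iUnion_eq_univ_iff.1 U.2.2 x
          exact Set.mem_iUnion.2 ⟨i, Or.inr ⟨hi, hx⟩⟩)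
    refine ⟨⟨v, hvo, hv⟩, fun i => (hvu i).trans
      (Set.union_subset (hWU i) Set.sdiff_subset), fun x hx s hs => hord x s fun i hi => ?_⟩
    rcases hvu i (hs i hi) with h | h
    exacts [h, absurd hx h.2]
  choose f hf1 hf2 using step
  let T : ℕ → S := fun j => Nat.rec ⟨U, hU, hcov⟩ (fun j V => f j V) j
  have hT (j : ℕ) : T (j + 1) = f j (T j) := rfl
  have hanti (i : Fin k) : Antitone fun j => (T j).1 i :=
    antitone_nat_of_succ_le fun j => by
      rw [hT]
      exact subset_closure.trans (hf1 j (T j) i)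
  -- The limits of the nested shrinkings are closed and have multiplicity at most `m` on every
  -- compact piece, hence everywhere.
  obtain ⟨W, hW, hWU, hCW, hord⟩ := exists_isOpen_swelling (m := m) (U := U)
    (C := fun i => ⋂ j, closure ((T (j + 1)).1 i)) (fun i => isClosed_iInter fun _ =>
      isClosed_closure) hU (fun i x hx => hf1 0 (T 0) i (Set.mem_iInter.1 hx 0)) (by
      intro x s hs
      obtain ⟨j, hj⟩ := exists_mem_compactCovering x
      exact hf2 j (T j) x hj s fun i hi => Set.mem_iInter.1 (hs i hi) j)
  refine ⟨W, hW, hWU, Set.eq_univ_of_forall fun x => ?_, hord⟩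
  -- There are finitely many indices and the sets decrease in `j`: otherwise some stage would miss
  -- `x` altogether.
  have : ∃ i, ∀ j, x ∈ (T j).1 i := by
    by_contra! hcon
    choose d hd using hcon
    obtain ⟨i, hi⟩ := Set.iUnion_eq_univ_iff.1 (T (Finset.univ.sup d)).2.2 x
    exact hd i (hanti i (Finset.le_sup (Finset.mem_univ i)) hi)
  obtain ⟨i, hi⟩ := this
  exact Set.mem_iUnion.2 ⟨i, hCW i (Set.mem_iInter.2 fun j => subset_closure (hi (j + 1)))⟩

end Covering

/-! ### From approximate eigenprojections to covers of bounded order -/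

section Core

universe v

variable {F : Type v} [CStarAlgebra F]

/-- As for eigenvectors of a self-adjoint operator: `(s - t) v⋆w = v⋆(c - t)w - ((c - s)v)⋆w`, and
both terms are small. -/
theorem norm_star_mul_le_of_approx_eigenvector {c e q r v w : F} {s t ε γ : ℝ}
    (he : IsStarProjection e) (hc : IsSelfAdjoint c) (hv : star v * v = e) (hv' : v * star v = q)
    (hw : star w * w = e) (hw' : w * star w = r) (hq : ‖(c - (s : ℂ) • 1) * q‖ ≤ ε)
    (hr : ‖(c - (t : ℂ) • 1) * r‖ ≤ ε) (hγ : 0 < γ) (hst : γ ≤ |s - t|) :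
    ‖star v * w‖ ≤ 2 * ε / γ := by
  have hn (v : F) (hv : star v * v = e) : ‖v‖ ≤ 1 := by
    have h1 : ‖v‖ * ‖v‖ = ‖e‖ := by rw [← hv, CStarRing.norm_star_mul_self]
    have h2 : ‖e‖ ≤ 1 := he.norm_le
    nlinarith [norm_nonneg v]
  have hb (v q : F) (hv : star v * v = e) (hv' : v * star v = q) (s : ℝ)
      (hq : ‖(c - (s : ℂ) • 1) * q‖ ≤ ε) : ‖(c - (s : ℂ) • 1) * v‖ ≤ ε := by
    have : q * v = v := by rw [← hv', mul_assoc, hv, mul_eq_self_of_star_mul_self he hv]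
    calc ‖(c - (s : ℂ) • 1) * v‖ = ‖(c - (s : ℂ) • 1) * q * v‖ := by rw [mul_assoc, this]
      _ ≤ ‖(c - (s : ℂ) • 1) * q‖ * ‖v‖ := norm_mul_le _ _
      _ ≤ ε * 1 := mul_le_mul hq (hn v hv) (norm_nonneg _) ((norm_nonneg _).trans hq)
      _ = ε := mul_one _
  have h1 := hb v q hv hv' s hq
  have h2 := hb w r hw hw' t hr
  have key : ((s - t : ℝ) : ℂ) • (star v * w) =
      star v * ((c - (t : ℂ) • 1) * w) - star ((c - (s : ℂ) • 1) * v) * w := by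
    simp only [star_mul, star_sub, star_smul, hc.star_eq, Complex.star_def,
      Complex.conj_ofReal, sub_mul, mul_sub, smul_mul_assoc, mul_smul_comm, one_mul,
      mul_assoc, Complex.ofReal_sub]
    module
  have hle : |s - t| * ‖star v * w‖ ≤ 2 * ε := by
    have : ‖((s - t : ℝ) : ℂ)‖ = |s - t| := by rw [Complex.norm_real, Real.norm_eq_abs]
    rw [← this, ← norm_smul, key]
    refine (norm_sub_le _ _).trans ?_
    have e1 : ‖star v * ((c - (t : ℂ) • 1) * w)‖ ≤ 1 * ε := (norm_mul_le _ _).trans <|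
      mul_le_mul (by rw [norm_star]; exact hn v hv) h2 (norm_nonneg _) zero_le_one
    have e2 : ‖star ((c - (s : ℂ) • 1) * v) * w‖ ≤ ε * 1 := (norm_mul_le _ _).trans <|
      mul_le_mul (by rw [norm_star]; exact h1) (hn w hw) (norm_nonneg _)
        ((norm_nonneg _).trans h1)
    linarith
  rw [le_div_iff₀ hγ, mul_comm]
  exact (mul_le_mul_of_nonneg_right hst (norm_nonneg _)).trans hle

variable [PartialOrder F] [StarOrderedRing F]

theorem mul_ne_zero_of_pos {g : F →ₗ[ℝ] ℝ} (hg : ∀ y, 0 ≤ y → 0 ≤ g y) {z q : F}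
    (hz : IsStarProjection z) (hq : IsStarProjection q) (hgz : g (1 - z) = 0) (hgq : 0 < g q) :
    z * q ≠ 0 := by
  intro h
  have h' : q * z = 0 := by
    simpa [hz.isSelfAdjoint.star_eq, hq.isSelfAdjoint.star_eq] using congr(star $h)
  have hle : q ≤ 1 - z := hq.le_of_mul_eq_left hz.one_sub (by rw [mul_sub, h', mul_one, sub_zero])
  have := hg _ (sub_nonneg.2 hle)
  rw [map_sub, hgz] at this
  linarith

/-- From a field of positive functionals on a finite-dimensional C⋆-algebra which are uniformly
concentrated on at most `m` orthogonal minimal projections, and approximate joint eigenvectors for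
a finite family of functions, one obtains a cover of order at most `m` whose members have small
oscillation. -/
theorem exists_cover_of_approx_eigenvectors [FiniteDimensional ℂ F] {X : Type u}
    [TopologicalSpace X] {K : Set X} {g : X → F →ₗ[ℝ] ℝ} (hg : ∀ x y, 0 ≤ y → 0 ≤ g x y)
    (hgc : ∀ y, Continuous fun x => g x y) {k m : ℕ} {a : Fin k → X → ℝ}
    (ha : ∀ i, Continuous (a i)) {c : Fin k → F} (hc : ∀ i, IsSelfAdjoint (c i))
    (hm : ∀ x, ∀ Q : Finset F, IsElementary Q → (∀ q ∈ Q, 0 < g x q) → Q.card ≤ m)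
    {γ ε : ℝ} (hγ : 0 < γ) (hε : 0 < ε) (hsmall : ((m + 1 : ℕ) : ℝ) * (2 * ε / γ) < 1)
    (H : ∀ x ∈ K, ∃ q : F, IsMinimalProjection q ∧ 0 < g x q ∧
      ∀ i, ‖(c i - (a i x : ℂ) • 1) * q‖ < ε) :
    ∃ (κ : Type (max u v)) (V : κ → Set X) (p : κ → X), (∀ j, IsOpen (V j)) ∧ K ⊆ ⋃ j, V j ∧
      (∀ x, ∀ s : Finset κ, (∀ j ∈ s, x ∈ V j) → s.card ≤ m) ∧
      ∀ j, p j ∈ K ∧ ∀ x ∈ V j, ∀ i, |a i x - a i (p j)| < γ := by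
  classical
  let P := {e : F // IsMinimalProjection e}
  let st : Setoid P := ⟨fun e f => MvNEquiv e.1 f.1, fun e => .refl e.2.1, fun h => h.symm,
    fun {e _ f} h h' => h.trans e.2.1 f.2.1 h'⟩
  let V₀ : P → Set X := fun e => {x | ∃ q, MvNEquiv e.1 q ∧ 0 < g x q ∧
      ∀ i, ‖(c i - (a i x : ℂ) • 1) * q‖ < ε}
  have hmin (e : P) (q : F) (h : MvNEquiv e.1 q) : IsMinimalProjection q := by
    obtain ⟨v, h1, h2⟩ := h
    exact h2 ▸ e.2.mul_star h1
  have hV₀ (e : P) : IsOpen (V₀ e) := by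
    have : V₀ e = ⋃ q ∈ {q | MvNEquiv e.1 q}, ({x | 0 < g x q} ∩
        ⋂ i, {x | ‖(c i - (a i x : ℂ) • 1) * q‖ < ε}) := by
      ext x
      simp only [V₀, Set.mem_ofPred_eq, Set.mem_iUnion, Set.mem_inter_iff, Set.mem_iInter,
        exists_prop]
    rw [this]
    refine isOpen_biUnion fun q _ => (isOpen_lt continuous_const (hgc q)).inter
      (isOpen_iInter_of_finite fun i => isOpen_lt ?_ continuous_const)
    have := ha i
    fun_prop
  have hcount (x : X) (S : Finset P) (hS : ∀ e ∈ S, ∀ f ∈ S, MvNEquiv e.1 f.1 → e = f)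
      (hx : ∀ e ∈ S, x ∈ V₀ e) :
      ∑ e ∈ S, Module.finrank ℂ (LinearMap.range (LinearMap.mulRight ℂ e.1)) ≤ m := by
    obtain ⟨Q, hQ, hQm, hz, hgz⟩ := exists_central_support (hg x) (hm x)
    refine le_trans ?_ hQm
    rw [← Finset.sum_image (f := fun e : F => Module.finrank ℂ
      (LinearMap.range (LinearMap.mulRight ℂ e))) (g := Subtype.val)
      Subtype.val_injective.injOn]
    refine sum_finrank_range_mulRight_le_card hQ hz ?_ ?_ ?_
    · intro e he
      obtain ⟨e, -, rfl⟩ := Finset.mem_image.1 he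
      exact e.2
    · intro e he f hf hef
      obtain ⟨e, he', rfl⟩ := Finset.mem_image.1 he
      obtain ⟨f, hf', rfl⟩ := Finset.mem_image.1 hf
      rw [hS e he' f hf' hef]
    · intro e he
      obtain ⟨e, he', rfl⟩ := Finset.mem_image.1 he
      obtain ⟨q, hq, hgq, -⟩ := hx e he'
      exact ⟨q, hq, mul_ne_zero_of_pos (hg x) hQ.isStarProjection_sum (hmin e q hq).1 hgz hgq⟩
  have hsep (e : P) (C : Finset X) (hC : ∀ x ∈ C, x ∈ V₀ e)
      (hs : ∀ x ∈ C, ∀ y ∈ C, x ≠ y → ∃ i, γ ≤ |a i x - a i y|) :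
      C.card ≤ Module.finrank ℂ (LinearMap.range (LinearMap.mulRight ℂ e.1)) := by
    by_contra! hlt
    -- Keeping just one point more than the rank, which is at most `m`, leaves at most `m + 1`
    -- points, as `hsmall` requires.
    obtain ⟨D, hDC, hD⟩ := Finset.exists_subset_card_eq (Nat.succ_le_of_lt hlt)
    obtain ⟨x₀, hx₀⟩ : C.Nonempty := Finset.card_pos.1 (by omega)
    have hrm := hcount x₀ {e} (by simp) (by simpa using hC x₀ hx₀)
    rw [Finset.sum_singleton] at hrm
    have hex : ∀ x : D, ∃ v q : F, star v * v = e.1 ∧ v * star v = q ∧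
        ∀ i, ‖(c i - (a i x : ℂ) • 1) * q‖ < ε := fun x => by
      obtain ⟨q, ⟨v, h1, h2⟩, -, h⟩ := hC x (hDC x.2)
      exact ⟨v, q, h1, h2, h⟩
    choose v q h1 h2 h3 using hex
    have hδ : (0 : ℝ) ≤ 2 * ε / γ := by positivity
    have := card_le_finrank_range_mulRight e.2 v h1 hδ (by
      refine lt_of_le_of_lt (mul_le_mul_of_nonneg_right ?_ hδ) hsmall
      rw [Fintype.card_coe, hD]
      exact_mod_cast Nat.succ_le_succ hrm) (fun s t hst => by
      obtain ⟨i, hi⟩ := hs s (hDC s.2) t (hDC t.2) (fun h => hst (Subtype.ext h))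
      exact norm_star_mul_le_of_approx_eigenvector e.2.1 (hc i) (h1 s) (h2 s) (h1 t) (h2 t)
        (h3 s i).le (h3 t i).le hγ hi)
    rw [Fintype.card_coe, hD] at this
    omega
  have hcent (e : P) : ∃ C : Finset X, (∀ x ∈ C, x ∈ K) ∧
      C.card ≤ Module.finrank ℂ (LinearMap.range (LinearMap.mulRight ℂ e.1)) ∧
      ∀ x ∈ V₀ e, x ∈ K → ∃ y ∈ C, ∀ i, |a i x - a i y| < γ := by
    -- A maximal `γ`-separated set is a `γ`-net.
    obtain ⟨C, ⟨hC, hCs⟩, hmax⟩ := exists_max_card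
      (P := fun C : Finset X => (∀ x ∈ C, x ∈ V₀ e ∧ x ∈ K) ∧
        ∀ x ∈ C, ∀ y ∈ C, x ≠ y → ∃ i, γ ≤ |a i x - a i y|) (by simp)
      (fun C hC => hsep e C (fun x hx => (hC.1 x hx).1) hC.2)
    refine ⟨C, fun x hx => (hC x hx).2, hsep e C (fun x hx => (hC x hx).1) hCs, fun x hx hxK => ?_⟩
    by_contra! hcon
    have hxC : x ∉ C := fun hxC => by
      obtain ⟨i, hi⟩ := hcon x hxC
      rw [sub_self, abs_zero] at hi
      linarith
    have := hmax (insert x C) ⟨fun y hy => by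
      rcases Finset.mem_insert.1 hy with rfl | hy
      exacts [⟨hx, hxK⟩, hC y hy], fun y hy z hz hyz => by
      rcases Finset.mem_insert.1 hy with rfl | hy'
      · rcases Finset.mem_insert.1 hz with rfl | hz'
        exacts [absurd rfl hyz, hcon z hz']
      · rcases Finset.mem_insert.1 hz with rfl | hz'
        · obtain ⟨i, hi⟩ := hcon y hy'
          exact ⟨i, abs_sub_comm (a i z) _ ▸ hi⟩
        · exact hCs y hy' z hz' hyz⟩
    rw [Finset.card_insert_of_notMem hxC] at this
    omega
  choose C hCK hCc hCcov using hcent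
  refine ⟨Σ b : Quotient st, C b.out, fun j => V₀ j.1.out ∩ {x | ∀ i, |a i x - a i j.2.1| < γ},
    fun j => j.2.1, fun j => ?_, fun x hx => ?_, fun x s hs => ?_, fun j => ⟨hCK _ _ j.2.2,
      fun x hx => hx.2⟩⟩
  · refine (hV₀ _).inter ?_
    rw [Set.ofPred_forall]
    refine isOpen_iInter_of_finite fun i => isOpen_lt ?_ continuous_const
    have := ha i
    fun_prop
  · obtain ⟨q, hq, hgq, hqi⟩ := H x hx
    let b : Quotient st := Quotient.mk st ⟨q, hq⟩
    have hb : MvNEquiv b.out.1 q := Quotient.exact (Quotient.out_eq b)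
    have hxV : x ∈ V₀ b.out := ⟨q, hb, hgq, hqi⟩
    obtain ⟨y, hy, hxy⟩ := hCcov b.out x hxV hx
    exact Set.mem_iUnion.2 ⟨⟨b, y, hy⟩, hxV, hxy⟩
  -- Each class contributes at most its rank, and the ranks of the classes seen at `x` add up to at
  -- most `m`.
  · calc s.card ≤ ((s.image Sigma.fst).sigma fun b => (Finset.univ : Finset (C b.out))).card :=
          Finset.card_le_card fun j hj => by
            simpa using ⟨j.2.1, j.2.2, hj⟩
      _ = ∑ b ∈ s.image Sigma.fst, (C b.out).card := by
          rw [Finset.card_sigma]; simp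
      _ ≤ ∑ b ∈ s.image Sigma.fst,
          Module.finrank ℂ (LinearMap.range (LinearMap.mulRight ℂ b.out.1)) :=
          Finset.sum_le_sum fun b _ => hCc _
      _ = ∑ e ∈ (s.image Sigma.fst).image Quotient.out,
          Module.finrank ℂ (LinearMap.range (LinearMap.mulRight ℂ e.1)) :=
          (Finset.sum_image (g := Quotient.out) (f := fun e : P => Module.finrank ℂ
            (LinearMap.range (LinearMap.mulRight ℂ e.1))) Quotient.out_injective.injOn).symm
      _ ≤ m := by
          refine hcount x _ ?_ ?_
          · intro e he f hf hef
            obtain ⟨b, -, rfl⟩ := Finset.mem_image.1 he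
            obtain ⟨d, -, rfl⟩ := Finset.mem_image.1 hf
            rw [(Quotient.out_equiv_out (s := st)).1 hef]
          · intro e he
            obtain ⟨b, hb, rfl⟩ := Finset.mem_image.1 he
            obtain ⟨j, hj, rfl⟩ := Finset.mem_image.1 hb
            exact (hs j hj).1

end Core

/-! ### The Kadison–Schwarz inequality -/

section KadisonSchwarz

variable {A F : Type*} [NonUnitalCStarAlgebra A] [PartialOrder A] [StarOrderedRing A]
  [CStarAlgebra F] [PartialOrder F] [StarOrderedRing F]

theorem CStarMatrix.sum_star_mul_mul_nonneg {ι : Type*} [Fintype ι] {M : CStarMatrix ι ι F}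
    (hM : 0 ≤ M) (w : ι → F) : 0 ≤ ∑ i, ∑ j, star (w i) * M i j * w j := by
  rw [StarOrderedRing.nonneg_iff] at hM
  induction hM using AddSubmonoid.closure_induction with
  | mem M hM =>
    obtain ⟨N, rfl⟩ := hM
    have : ∑ i, ∑ j, star (w i) * (star N * N) i j * w j =
        ∑ l, star (∑ i, N l i * w i) * ∑ j, N l j * w j := by
      simp only [CStarMatrix.mul_apply, CStarMatrix.star_apply, star_sum,
        star_mul, Finset.mul_sum, Finset.sum_mul, mul_assoc]
      rw [Finset.sum_congr rfl fun i _ => Finset.sum_comm, Finset.sum_comm]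
      exact Finset.sum_congr rfl fun l _ => Finset.sum_comm
    rw [this]
    exact Finset.sum_nonneg fun l _ => star_mul_self_nonneg _
  | zero => simp
  | add M N _ _ hM hN => simpa [mul_add, add_mul, Finset.sum_add_distrib] using add_nonneg hM hN

/-- The Kadison–Schwarz inequality, for an element with a local unit. -/
theorem CompletelyPositiveMap.mul_self_le (ψ : A →CP F) (hψ : ∀ x, ‖ψ x‖ ≤ ‖x‖) {a u : A}
    (ha : IsSelfAdjoint a) (hu : 0 ≤ u) (hu1 : ‖u‖ ≤ 1) (hau : a * u = a) :
    ψ a * ψ a ≤ ψ (a * a) := by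
  have hus : IsSelfAdjoint u := .of_nonneg hu
  have hua : u * a = a := by simpa [ha.star_eq, hus.star_eq] using congr(star $hau)
  -- Here `star z * z` has rows `(a², a)` and `(a, u²)`, with `u` standing in for the unit. Testing
  -- its image on `(1, -ψ a)` gives the claim, since `ψ (u²) ≤ 1`.
  let z : CStarMatrix (Fin 2) (Fin 2) A := CStarMatrix.ofMatrix !![a, u; 0, 0]
  have hpos := CStarMatrix.sum_star_mul_mul_nonneg
    (ψ.map_cstarMatrix_nonneg (star z * z) (star_mul_self_nonneg z)) ![1, -ψ a]
  set c := ψ a with hc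
  have hcs : IsSelfAdjoint c := ha.map' ψ
  have huu : ψ (u * u) ≤ 1 := by
    have h0 : 0 ≤ u * u := by
      have := star_mul_self_nonneg u
      rwa [hus.star_eq] at this
    rw [← CStarAlgebra.norm_le_one_iff_of_nonneg _ (map_nonneg ψ h0)]
    refine (hψ _).trans ((norm_mul_le _ _).trans ?_)
    exact mul_le_one₀ hu1 (norm_nonneg _) hu1
  have hconj : c * ψ (u * u) * c ≤ c * c := by
    have := star_left_conjugate_le_conjugate huu c
    rwa [hcs.star_eq, mul_one] at this
  rw [← sub_nonneg]
  calc (0 : F) ≤ ψ (a * a) - c * c - c * c + c * ψ (u * u) * c := by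
        refine hpos.trans_eq ?_
        simp only [z, CStarMatrix.map_apply, CStarMatrix.mul_apply, CStarMatrix.star_apply,
          Fin.sum_univ_two, CStarMatrix.ofMatrix_apply, Matrix.of_apply, Matrix.cons_val_zero,
          Matrix.cons_val_one, ha.star_eq, hus.star_eq, hau, hua, star_zero, zero_mul, add_zero,
          star_neg, star_one, hcs.star_eq, ← hc]
        noncomm_ring
    _ ≤ ψ (a * a) - c * c - c * c + c * c := by gcongr
    _ = ψ (a * a) - c * c := by abel

end KadisonSchwarz

/-! ### Point evaluations on `C₀(X, ℂ)` -/

section ZeroAtInfty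

variable {X : Type u} [TopologicalSpace X]

/-- A compactly supported real function as an element of `C₀(X, ℂ)`. -/
noncomputable def ContinuousMap.toC₀ (f : C(X, ℝ)) (hf : HasCompactSupport f) : C₀(X, ℂ) where
  toFun x := (f x : ℂ)
  continuous_toFun := by fun_prop
  zero_at_infty' :=
    HasCompactSupport.is_zero_at_infty (hf.comp_left (g := fun r : ℝ => (r : ℂ)) (by simp))

@[simp]
theorem ContinuousMap.toC₀_apply (f : C(X, ℝ)) (hf : HasCompactSupport f) (x : X) :
    f.toC₀ hf x = (f x : ℂ) := rfl

theorem ContinuousMap.isSelfAdjoint_toC₀ (f : C(X, ℝ)) (hf : HasCompactSupport f) :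
    IsSelfAdjoint (f.toC₀ hf) := by
  ext x
  simp

theorem ZeroAtInftyContinuousMap.norm_apply_le (f : C₀(X, ℂ)) (x : X) : ‖f x‖ ≤ ‖f‖ :=
  BoundedContinuousFunction.norm_coe_le_norm f.toBCF x

theorem ZeroAtInftyContinuousMap.norm_le_of_forall (f : C₀(X, ℂ)) {r : ℝ} (hr : 0 ≤ r)
    (h : ∀ x, ‖f x‖ ≤ r) : ‖f‖ ≤ r := by
  rw [← ZeroAtInftyContinuousMap.norm_toBCF_eq_norm]
  exact (BoundedContinuousFunction.norm_le hr).2 h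

variable [PartialOrder C₀(X, ℂ)] [StarOrderedRing C₀(X, ℂ)]

theorem ContinuousMap.toC₀_nonneg (f : C(X, ℝ)) (hf : HasCompactSupport f) (h : ∀ x, 0 ≤ f x) :
    0 ≤ f.toC₀ hf := by
  let r : C(X, ℝ) := ⟨fun x => √(f x), by fun_prop⟩
  have hr : HasCompactSupport r := hf.comp_left (g := Real.sqrt) (by simp)
  have : f.toC₀ hf = star (r.toC₀ hr) * r.toC₀ hr := by
    ext x
    simp [r, ← Complex.ofReal_mul, Real.mul_self_sqrt (h x)]
  rw [this]
  exact star_mul_self_nonneg _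

theorem ZeroAtInftyContinuousMap.re_apply_nonneg {f : C₀(X, ℂ)} (hf : 0 ≤ f) (x : X) :
    0 ≤ (f x).re := by
  obtain ⟨b, rfl⟩ := CStarAlgebra.nonneg_iff_eq_star_mul_self.1 hf
  simp only [ZeroAtInftyContinuousMap.mul_apply, ZeroAtInftyContinuousMap.star_apply,
    Complex.star_def, Complex.mul_re, Complex.conj_re, Complex.conj_im]
  nlinarith [mul_self_nonneg (b x).re, mul_self_nonneg (b x).im]

theorem CPRankLE.exists_approx {A : Type u} [NonUnitalCStarAlgebra A] [PartialOrder A]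
    [StarOrderedRing A] {n : ℤ} (h : CPRankLE A n) {ι : Type*} [Finite ι] (a : ι → A) {ε : ℝ}
    (hε : 0 < ε) : ∃ (F : Type) (_ : CStarAlgebra F) (_ : PartialOrder F) (_ : StarOrderedRing F)
      (ψ : A →CP F) (φ : F →CP A),
      FiniteDimensional ℂ F ∧ (∀ x, ‖ψ x‖ ≤ ‖x‖) ∧ (∀ y, ‖φ y‖ ≤ ‖y‖) ∧
      (∀ i, ‖φ (ψ (a i)) - a i‖ < ε) ∧ StrictOrderLE φ n := by
  have := Fintype.ofFinite ι
  obtain ⟨F, i1, i2, i3, ψ, φ, hF, hψ, hφ, happ, hord⟩ :=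
    h _ (a ∘ (Fintype.equivFin ι).symm) ε hε
  exact ⟨F, i1, i2, i3, ψ, φ, hF, hψ, hφ, fun i => by simpa using happ (Fintype.equivFin ι i), hord⟩

variable {F : Type*} [CStarAlgebra F] [PartialOrder F] [StarOrderedRing F]

/-- The positive functional `y ↦ Re (φ y x)`. -/
noncomputable def CompletelyPositiveMap.evalRe (φ : F →CP C₀(X, ℂ)) (x : X) : F →ₗ[ℝ] ℝ where
  toFun y := (φ y x).re
  map_add' y z := by simp [map_add]
  map_smul' r y := by
    rw [← Complex.coe_smul, map_smul]
    simp

theorem CompletelyPositiveMap.evalRe_apply (φ : F →CP C₀(X, ℂ)) (x : X) (y : F) :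
    φ.evalRe x y = (φ y x).re := rfl

theorem CompletelyPositiveMap.evalRe_nonneg (φ : F →CP C₀(X, ℂ)) (x : X) (y : F) (hy : 0 ≤ y) :
    0 ≤ φ.evalRe x y :=
  ZeroAtInftyContinuousMap.re_apply_nonneg (map_nonneg φ hy) x

/-- Orthogonal functions cannot both be nonzero at `x`. -/
theorem StrictOrderLE.card_le {φ : F →CP C₀(X, ℂ)} {n : ℤ} (h : StrictOrderLE φ n) {m : ℕ}
    (hm : (m : ℤ) = n + 1) (x : X) (Q : Finset F) (hQ : IsElementary Q)
    (hpos : ∀ q ∈ Q, 0 < φ.evalRe x q) : Q.card ≤ m := by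
  by_contra! hlt
  obtain ⟨R, hR, hc⟩ := Finset.exists_subset_card_eq (Nat.succ_le_of_lt hlt)
  obtain ⟨e, he, f, hf, hef⟩ := h R (by rw [hc]; push_cast; omega) (hQ.subset hR)
  have h1 : φ e x * φ f x = 0 := by
    rw [← ZeroAtInftyContinuousMap.mul_apply, hef.1]; rfl
  have he' := hpos e (hR he)
  have hf' := hpos f (hR hf)
  rw [CompletelyPositiveMap.evalRe_apply] at he' hf'
  rcases mul_eq_zero.1 h1 with h | h
  · rw [h] at he'; simp at he'
  · rw [h] at hf'; simp at hf'

end ZeroAtInfty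

/-! ### Covering dimension is at most the completely positive rank -/

section LowerBound

variable {X : Type u} [TopologicalSpace X] [PartialOrder C₀(X, ℂ)] [StarOrderedRing C₀(X, ℂ)]
  {F : Type*} [CStarAlgebra F] [PartialOrder F] [StarOrderedRing F]

theorem CompletelyPositiveMap.evalRe_one_le (φ : F →CP C₀(X, ℂ)) (hφ : ∀ y, ‖φ y‖ ≤ ‖y‖) (x : X) :
    φ.evalRe x 1 ≤ 1 := by
  rw [CompletelyPositiveMap.evalRe_apply]
  refine (Complex.re_le_norm _).trans ((ZeroAtInftyContinuousMap.norm_apply_le _ x).trans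
    ((hφ 1).trans ?_))
  exact IsStarProjection.norm_le _ (IsStarProjection.one F)

theorem CompletelyPositiveMap.evalRe_mono (φ : F →CP C₀(X, ℂ)) (x : X) {y z : F} (h : y ≤ z) :
    φ.evalRe x y ≤ φ.evalRe x z := by
  have := φ.evalRe_nonneg x _ (sub_nonneg.2 h)
  rwa [map_sub, sub_nonneg] at this

theorem CompletelyPositiveMap.abs_evalRe_sub_lt {φ : F →CP C₀(X, ℂ)} {y : F} {f : C(X, ℝ)}
    {hf : HasCompactSupport f} {ε : ℝ} (h : ‖φ y - f.toC₀ hf‖ < ε) (x : X) :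
    |φ.evalRe x y - f x| < ε := by
  have h1 : φ.evalRe x y - f x = ((φ y - f.toC₀ hf) x).re := by
    simp [CompletelyPositiveMap.evalRe_apply]
  rw [h1]
  exact (Complex.abs_re_le_norm _).trans_lt
    ((ZeroAtInftyContinuousMap.norm_apply_le _ x).trans_lt h)

/-- The multiplicative defect of an approximation at a point. -/
theorem evalRe_sub_smul_mul_self_le {φ : F →CP C₀(X, ℂ)} (hφ : ∀ y, ‖φ y‖ ≤ ‖y‖) {c d : F}
    (hcd : c * c ≤ d) {x : X} {t ε : ℝ} (ht0 : 0 ≤ t) (ht1 : t ≤ 1) (hε : 0 ≤ ε)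
    (hc : |φ.evalRe x c - t| < ε) (hd : |φ.evalRe x d - t * t| < ε) :
    φ.evalRe x ((c - (t : ℂ) • 1) * (c - (t : ℂ) • 1)) ≤ 3 * ε := by
  -- The resulting bound is `(t² + ε) - 2t(t - ε) + t² = ε + 2tε ≤ 3ε`.
  have hexp : (c - (t : ℂ) • 1) * (c - (t : ℂ) • 1) = c * c - (2 * t) • c + (t * t) • (1 : F) := by
    rw [Complex.coe_smul]
    simp only [sub_mul, mul_sub, smul_mul_assoc, mul_smul_comm, one_mul, mul_one]
    module
  have h1 := φ.evalRe_one_le hφ x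
  have h2 := φ.evalRe_mono x hcd
  rw [hexp, map_add, map_sub, map_smul, map_smul, smul_eq_mul, smul_eq_mul]
  rw [abs_lt] at hc hd
  have h3 : t * t * φ.evalRe x 1 ≤ t * t := by
    have := mul_le_mul_of_nonneg_left h1 (mul_nonneg ht0 ht0)
    linarith
  have h4 : 2 * t * (t - ε) ≤ 2 * t * φ.evalRe x c :=
    mul_le_mul_of_nonneg_left (by linarith) (by linarith)
  have h5 : t * ε ≤ ε := by nlinarith
  nlinarith

theorem norm_sub_smul_mul_lt {k : ℕ} {d : Fin k → F} (hd : ∀ i, IsSelfAdjoint (d i)) {q : F}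
    (hq : IsStarProjection q) {η : ℝ} (hη : 0 ≤ η)
    (h : ‖q * (∑ i, d i * d i) * q‖ ≤ η ^ 2) (i : Fin k) : ‖d i * q‖ ≤ η := by
  have hqs : star q = q := hq.isSelfAdjoint
  have hnn (j : Fin k) : 0 ≤ d j * d j := (hd j).mul_self_nonneg
  have hle : q * (d i * d i) * q ≤ q * (∑ i, d i * d i) * q := by
    have := star_left_conjugate_le_conjugate
      (Finset.single_le_sum (f := fun j => d j * d j) (fun j _ => hnn j) (Finset.mem_univ i)) q
    rwa [hqs] at this
  have h0 : 0 ≤ q * (d i * d i) * q := by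
    have := star_left_conjugate_nonneg (hnn i) q
    rwa [hqs] at this
  have h1 : ‖d i * q‖ * ‖d i * q‖ = ‖q * (d i * d i) * q‖ := by
    rw [← CStarRing.norm_star_mul_self, star_mul, hqs, (hd i).star_eq]
    simp only [mul_assoc]
  have h2 := (CStarAlgebra.norm_le_norm_of_nonneg_of_le h0 hle).trans h
  rw [← h1] at h2
  exact abs_le_of_sq_le_sq' (by nlinarith) hη |>.2

variable [T2Space X] [LocallyCompactSpace X]

theorem CPRankLE.exists_refinement_of_isCompact {n : ℤ} {m : ℕ} (hm : (m : ℤ) = n + 1)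
    (h : CPRankLE C₀(X, ℂ) n) {K : Set X} (hK : IsCompact K) {k : ℕ} {U : Fin k → Set X}
    (hU : ∀ i, IsOpen (U i)) (hKU : K ⊆ ⋃ i, U i) :
    ∃ W : Fin k → Set X, (∀ i, IsOpen (W i)) ∧ (∀ i, W i ⊆ U i) ∧ K ⊆ ⋃ i, W i ∧
      ∀ x, ∀ s : Finset (Fin k), (∀ i ∈ s, x ∈ W i) → s.card ≤ m := by
  obtain ⟨f, hfU, hf1, hf01, hfc⟩ := exists_continuous_sum_one_of_isOpen_isCompact hU hK hKU
  obtain ⟨w, hw1, -, hwc, hw01⟩ := exists_continuous_one_zero_of_isCompact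
    (hK.union (isCompact_iUnion fun i => hfc i)) isClosed_empty (Set.disjoint_empty _)
  have hfw (i : Fin k) (x : X) : f i x * w x = f i x := by
    by_cases hx : x ∈ tsupport (f i)
    · rw [hw1 (Or.inr (Set.mem_iUnion.2 ⟨i, hx⟩)), Pi.one_apply, mul_one]
    · rw [image_eq_zero_of_notMem_tsupport hx, zero_mul]
  have hff (i : Fin k) : HasCompactSupport (f i * f i) := (hfc i).mul_left
  -- Below `1 / k`, so at each point of `K` some `f i` is at least `γ`; also meaningful for `k = 0`.
  set γ : ℝ := 1 / (k + 1) with hγdef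
  have hγ : 0 < γ := by positivity
  -- Makes `(m + 1) * (2δ / γ) = (m + 1) / (m + 2) < 1`.
  set δ : ℝ := γ / (2 * (m + 2)) with hδdef
  have hδ : 0 < δ := by positivity
  -- The first bound gives the unit mass at least `3/4` on `K`; the second keeps the total defect
  -- `3kε` at most `(δ/2)² / 2`, below `(δ/2)²` times that mass.
  set ε : ℝ := min (1 / 4) ((δ / 2) ^ 2 / (6 * (k + 1))) with hεdef
  have hε : 0 < ε := by positivity
  obtain ⟨F, _, _, _, ψ, φ, hF, hψ, hφ, happ, hord⟩ := h.exists_approx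
    (Sum.elim (fun i => (f i).toC₀ (hfc i)) (Sum.elim (fun i => (f i * f i).toC₀ (hff i))
      (fun _ : Unit => w.toC₀ hwc))) hε
  have happ1 (i : Fin k) := happ (Sum.inl i)
  have happ2 (i : Fin k) := happ (Sum.inr (Sum.inl i))
  have happ3 := happ (Sum.inr (Sum.inr ()))
  simp only [Sum.elim_inl, Sum.elim_inr] at happ1 happ2 happ3
  have hwnorm : ‖w.toC₀ hwc‖ ≤ 1 := by
    refine ZeroAtInftyContinuousMap.norm_le_of_forall _ zero_le_one fun x => ?_
    rw [ContinuousMap.toC₀_apply, Complex.norm_real, Real.norm_eq_abs, abs_of_nonneg (hw01 x).1]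
    exact (hw01 x).2
  have hw0 : 0 ≤ w.toC₀ hwc := w.toC₀_nonneg hwc fun x => (hw01 x).1
  set c : Fin k → F := fun i => ψ ((f i).toC₀ (hfc i)) with hc
  have hcs (i : Fin k) : IsSelfAdjoint (c i) := ((f i).isSelfAdjoint_toC₀ (hfc i)).map' ψ
  have hcc (i : Fin k) : c i * c i ≤ ψ ((f i * f i).toC₀ (hff i)) := by
    have heq : (f i * f i).toC₀ (hff i) = (f i).toC₀ (hfc i) * (f i).toC₀ (hfc i) := by
      ext x; simp
    rw [heq]
    refine ψ.mul_self_le hψ ((f i).isSelfAdjoint_toC₀ (hfc i)) hw0 hwnorm ?_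
    ext x
    simp [← Complex.ofReal_mul, hfw]
  have hone (x : X) (hx : x ∈ K) : 3 / 4 ≤ φ.evalRe x 1 := by
    have h1 : ψ (w.toC₀ hwc) ≤ 1 := by
      rw [← CStarAlgebra.norm_le_one_iff_of_nonneg _ (map_nonneg ψ hw0)]
      exact (hψ _).trans hwnorm
    have h2 := φ.evalRe_mono x h1
    have h3 := CompletelyPositiveMap.abs_evalRe_sub_lt happ3 x
    rw [hw1 (Or.inl hx), Pi.one_apply, abs_lt] at h3
    have : ε ≤ 1 / 4 := min_le_left _ _
    linarith
  obtain ⟨κ, V, p, hV, hKV, hVord, hp⟩ := exists_cover_of_approx_eigenvectors (K := K)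
    (g := fun x => φ.evalRe x) (fun x => φ.evalRe_nonneg x)
    (fun y => Complex.continuous_re.comp (φ y).continuous) (a := fun i => f i) (c := c)
    (fun i => (f i).continuous) hcs (fun x => hord.card_le hm x) hγ hδ (by
      rw [hδdef, show 2 * (γ / (2 * ((m : ℝ) + 2))) / γ = 1 / (m + 2) by field_simp]
      push_cast
      rw [mul_one_div, div_lt_one (by positivity)]
      linarith) (by
      intro x hx
      set d : Fin k → F := fun i => c i - (f i x : ℂ) • 1 with hd
      have hds (i : Fin k) : IsSelfAdjoint (d i) := by
        refine (hcs i).sub ?_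
        rw [Complex.coe_smul]
        exact (IsSelfAdjoint.all (f i x)).smul (.one F)
      have hnn (i : Fin k) : 0 ≤ d i * d i := (hds i).mul_self_nonneg
      have hgd : φ.evalRe x (∑ i, d i * d i) ≤ k * (3 * ε) := by
        rw [map_sum]
        calc _ ≤ ∑ i : Fin k, 3 * ε := Finset.sum_le_sum fun i _ =>
              evalRe_sub_smul_mul_self_le hφ (hcc i) (hf01 i x).1 (hf01 i x).2 hε.le
                (CompletelyPositiveMap.abs_evalRe_sub_lt (happ1 i) x)
                (CompletelyPositiveMap.abs_evalRe_sub_lt (happ2 i) x)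
          _ = k * (3 * ε) := by simp
      have hkε : k * (3 * ε) < (δ / 2) ^ 2 * φ.evalRe x 1 := by
        have h1 : ε * (6 * (k + 1)) ≤ (δ / 2) ^ 2 := by
          rw [← le_div_iff₀ (by positivity)]
          exact min_le_right _ _
        have h2 := hone x hx
        have h3 : (δ / 2) ^ 2 * (3 / 4) ≤ (δ / 2) ^ 2 * φ.evalRe x 1 :=
          mul_le_mul_of_nonneg_left h2 (by positivity)
        have h4 : 0 ≤ k * ε := by positivity
        nlinarith
      obtain ⟨q, hq, hgq, hqd⟩ := exists_minimalProjection_norm_le (φ.evalRe_nonneg x)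
        (Finset.sum_nonneg fun i _ => hnn i) (by positivity) (hgd.trans_lt hkε)
      exact ⟨q, hq, hgq, fun i => (norm_sub_smul_mul_lt hds hq.1 (by positivity) hqd i).trans_lt
        (by linarith)⟩)
  have hVU (j : κ) : ∃ i, V j ⊆ U i := by
    obtain ⟨hpK, hpV⟩ := hp j
    obtain ⟨i, hi⟩ : ∃ i, γ ≤ f i (p j) := by
      by_contra! hcon
      have h1 : ∑ i, f i (p j) = 1 := by simpa using hf1 hpK
      have h2 : ∑ i, f i (p j) ≤ ∑ i : Fin k, γ := Finset.sum_le_sum fun i _ => (hcon i).le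
      rw [h1, Finset.sum_const, Finset.card_fin, nsmul_eq_mul, hγdef, mul_one_div,
        le_div_iff₀ (by positivity)] at h2
      linarith
    refine ⟨i, fun x hx => hfU i (subset_tsupport _ ?_)⟩
    have := hpV x hx i
    rw [abs_lt] at this
    rw [Function.mem_support]
    intro h0
    have h1 : f i x = 0 := h0
    linarith
  obtain ⟨W, hW, hWU, hVW, hWord⟩ := exists_grouping hV hVU hVord
  refine ⟨W, hW, hWU, hKV.trans (Set.iUnion_subset hVW), hWord⟩

end LowerBound

/-! ### Coloured partitions of unity -/

section ColouredPartition

variable {X : Type u} [TopologicalSpace X]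

/-- Adjoining the complement of `K` yields a cover of `X`; its member in the refinement misses `K`
and is discarded. -/
theorem CoveringDimLE.exists_refinement_of_isCompact [T2Space X] {n : ℤ} {m : ℕ}
    (hm : (m : ℤ) = n + 1) (h : CoveringDimLE X n) {K : Set X} (hK : IsCompact K) {k : ℕ}
    {U : Fin k → Set X} (hU : ∀ i, IsOpen (U i)) (hKU : K ⊆ ⋃ i, U i) :
    ∃ W : Fin k → Set X, (∀ i, IsOpen (W i)) ∧ (∀ i, W i ⊆ U i) ∧ K ⊆ ⋃ i, W i ∧
      ∀ x, ∀ s : Finset (Fin k), (∀ i ∈ s, x ∈ W i) → s.card ≤ m := by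
  obtain ⟨W, hW, hWU, hcov, hord⟩ := h.exists_finite_refinement hm
    (U := (Fin.cons Kᶜ U : Fin (k + 1) → Set X))
    (Fin.cases hK.isClosed.isOpen_compl hU) (by
      refine Set.eq_univ_of_forall fun x => ?_
      by_cases hx : x ∈ K
      · obtain ⟨i, hi⟩ := Set.mem_iUnion.1 (hKU hx)
        exact Set.mem_iUnion.2 ⟨i.succ, by simpa using hi⟩
      · exact Set.mem_iUnion.2 ⟨0, by simpa using hx⟩)
  refine ⟨fun i => W i.succ, fun i => hW _, fun i => by simpa using hWU i.succ, fun x hx => ?_,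
    fun x s hs => ?_⟩
  · obtain ⟨i, hi⟩ := Set.iUnion_eq_univ_iff.1 hcov x
    rcases Fin.eq_zero_or_eq_succ i with rfl | ⟨j, rfl⟩
    · exact absurd hx (by simpa using hWU 0 hi)
    · exact Set.mem_iUnion.2 ⟨j, hi⟩
  · rw [← Finset.card_map (Fin.succEmb k)]
    exact hord x _ (by simpa using hs)

variable [T2Space X] [LocallyCompactSpace X]

theorem exists_subpartition_of_isCompact {ι : Type*} [Fintype ι] {K : Set X} (hK : IsCompact K)
    {V : ι → Set X} (hV : ∀ i, IsOpen (V i)) (hKV : K ⊆ ⋃ i, V i) :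
    ∃ g : ι → C(X, ℝ), (∀ i, HasCompactSupport (g i)) ∧ (∀ i x, 0 ≤ g i x) ∧
      (∀ x, ∑ i, g i x ≤ 1) ∧ (∀ i x, g i x ≠ 0 → x ∈ V i) ∧ ∀ x ∈ K, ∑ i, g i x = 1 := by
  let e := Fintype.equivFin ι
  obtain ⟨f, hfV, hf1, hf01, hfc⟩ := exists_continuous_sum_one_of_isOpen_isCompact
    (s := V ∘ e.symm) (fun i => hV _) hK (by
      exact hKV.trans_eq (Function.Surjective.iUnion_comp e.symm.surjective V).symm)
  have hsum (x : X) : ∑ i, f (e i) x = ∑ j, f j x := Equiv.sum_comp e fun j => f j x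
  -- Off `K` the sum may exceed one; dividing by `D` corrects this and changes nothing on `K`.
  let D : C(X, ℝ) := ⟨fun x => max 1 (∑ j, f j x), by fun_prop⟩
  have hD (x : X) : 1 ≤ D x := le_max_left _ _
  have hD0 (x : X) : D x ≠ 0 := (zero_lt_one.trans_le (hD x)).ne'
  let r : C(X, ℝ) := ⟨fun x => (D x)⁻¹, D.continuous.inv₀ hD0⟩
  refine ⟨fun i => f (e i) * r, fun i => (hfc _).mul_right, fun i x => ?_, fun x => ?_,
    fun i x hx => ?_, fun x hx => ?_⟩
  · exact mul_nonneg (hf01 _ x).1 (inv_nonneg.2 (zero_le_one.trans (hD x)))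
  · simp only [ContinuousMap.mul_apply]
    rw [← Finset.sum_mul, hsum]
    change _ * (D x)⁻¹ ≤ 1
    rw [← div_eq_mul_inv, div_le_one (zero_lt_one.trans_le (hD x))]
    exact le_max_right _ _
  · have h1 : f (e i) x ≠ 0 := left_ne_zero_of_mul hx
    simpa using hfV (e i) (subset_tsupport _ h1)
  · simp only [ContinuousMap.mul_apply]
    have h1 : ∑ j, f j x = 1 := by simpa using hf1 hx
    rw [← Finset.sum_mul, hsum, h1, one_mul]
    change (max 1 (∑ j, f j x))⁻¹ = 1
    simp [h1]

/-- In a space of covering dimension less than `m`, there are arbitrarily fine partitions of unity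
over a compact set that decompose into `m` disjoint families. -/
theorem CoveringDimLE.exists_coloured_subpartition {n : ℤ} {m : ℕ} (hm : (m : ℤ) = n + 1)
    (h : CoveringDimLE X n) {k : ℕ} (a : Fin k → C₀(X, ℂ)) {ε : ℝ} (hε : 0 < ε) :
    ∃ (ι : Type) (_ : Fintype ι) (p : ι → X) (g : ι → C(X, ℝ)) (col : ι → ℕ),
      (∀ i, HasCompactSupport (g i)) ∧ (∀ i x, 0 ≤ g i x) ∧ (∀ x, ∑ i, g i x ≤ 1) ∧
      (∀ i, col i ∈ Finset.Icc 1 m) ∧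
      (∀ i j, i ≠ j → col i = col j → ∀ x, g i x * g j x = 0) ∧
      (∀ i x, g i x ≠ 0 → ∀ l, ‖a l x - a l (p i)‖ < ε) ∧
      ∀ x, ∑ i, g i x = 1 ∨ ∀ l, ‖a l x‖ < ε := by
  classical
  obtain ⟨K, hK, hKa⟩ : ∃ K : Set X, IsCompact K ∧ ∀ x ∉ K, ∀ l, ‖a l x‖ < ε := by
    have h1 : ∀ᶠ x in Filter.cocompact X, ∀ l, ‖a l x‖ < ε := by
      rw [Filter.eventually_all]
      intro l
      have := (zero_at_infty (a l)).eventually (Metric.ball_mem_nhds 0 hε)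
      simpa using this
    obtain ⟨K, hK, hsub⟩ := Filter.mem_cocompact.1 h1
    exact ⟨K, hK, fun x hx => hsub hx⟩
  let O : X → Set X := fun y => {x | ∀ l, ‖a l x - a l y‖ < ε}
  have hO (y : X) : IsOpen (O y) := by
    simp only [O, Set.ofPred_forall]
    refine isOpen_iInter_of_finite fun l => isOpen_lt ?_ continuous_const
    exact ((a l).continuous.sub continuous_const).norm
  obtain ⟨t, -, ht⟩ := hK.elim_nhds_subcover O fun y _ => (hO y).mem_nhds (by simp [O, hε])
  let y : Fin t.card → X := fun i => (t.equivFin.symm i : X)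
  obtain ⟨W, hW, hWO, hKW, hord⟩ := h.exists_refinement_of_isCompact hm hK (U := fun i => O (y i))
    (fun i => hO _) (fun x hx => by
      obtain ⟨z, hz, hxz⟩ := Set.mem_iUnion₂.1 (ht hx)
      exact Set.mem_iUnion.2 ⟨t.equivFin ⟨z, hz⟩, by simpa [y] using hxz⟩)
  obtain ⟨f, hfW, hf1, hf01, hfc⟩ := exists_continuous_sum_one_of_isOpen_isCompact hW hK hKW
  let ι := {S : Finset (Fin t.card) // S.Nonempty ∧ S.card ≤ m}
  -- As in barycentric subdivision, the colour is the size of `S`: distinct sets of equal size each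
  -- have an index the other lacks, and the two strict inequalities conflict.
  let V : ι → Set X := fun S => {x | ∀ i ∈ S.1, 0 < f i x ∧ ∀ j ∉ S.1, f j x < f i x}
  have hV (S : ι) : IsOpen (V S) := by
    have : V S = ⋂ i ∈ S.1, ({x | 0 < f i x} ∩ ⋂ j ∈ (S.1)ᶜ, {x | f j x < f i x}) := by
      ext x
      simp only [V, Set.mem_ofPred_eq, Set.mem_iInter, Set.mem_inter_iff, Finset.mem_compl]
    rw [this]
    exact isOpen_biInter_finset fun i _ => (isOpen_lt continuous_const (f i).continuous).inter
      (isOpen_biInter_finset fun j _ => isOpen_lt (f j).continuous (f i).continuous)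
  have hKV : K ⊆ ⋃ S, V S := by
    intro x hx
    have h1 : ∑ i, f i x = 1 := by simpa using hf1 hx
    have hne : Nonempty (Fin t.card) := by
      by_contra hemp
      rw [not_nonempty_iff] at hemp
      simp at h1
    obtain ⟨i₀, hi₀⟩ := Finite.exists_max fun i => f i x
    have hpos : 0 < f i₀ x := by
      by_contra! hle
      have : ∑ i, f i x ≤ 0 := Finset.sum_nonpos fun i _ => (hi₀ i).trans hle
      linarith
    -- The indices where `f i x` is maximal form a set `S` with `x ∈ V S`.
    refine Set.mem_iUnion.2 ⟨⟨Finset.univ.filter fun i => f i x = f i₀ x, ⟨i₀, by simp⟩,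
      hord x _ fun i hi => ?_⟩, fun i hi => ?_⟩
    · rw [Finset.mem_filter] at hi
      refine hfW i (subset_tsupport _ ?_)
      rw [Function.mem_support, hi.2]
      exact hpos.ne'
    · simp only [Finset.mem_filter, Finset.mem_univ, true_and] at hi ⊢
      refine ⟨hi ▸ hpos, fun j hj => ?_⟩
      rw [hi]
      exact lt_of_le_of_ne (hi₀ j) hj
  obtain ⟨g, hgc, hg0, hg1, hgV, hgK⟩ := exists_subpartition_of_isCompact hK hV hKV
  refine ⟨ι, inferInstance, fun S => y S.2.1.choose, g, fun S => S.1.card, hgc, hg0, hg1,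
    fun S => Finset.mem_Icc.2 ⟨S.2.1.card_pos, S.2.2⟩, fun S T hST hcard x => ?_,
    fun S x hx => ?_, fun x => ?_⟩
  · by_contra hne
    have hS := hgV S x (left_ne_zero_of_mul hne)
    have hT := hgV T x (right_ne_zero_of_mul hne)
    obtain ⟨i, hiS, hiT⟩ := Finset.not_subset.1 fun hsub =>
      hST (Subtype.ext (Finset.eq_of_subset_of_card_le hsub hcard.ge))
    obtain ⟨j, hjT, hjS⟩ := Finset.not_subset.1 fun hsub =>
      hST (Subtype.ext (Finset.eq_of_subset_of_card_le hsub hcard.le).symm)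
    exact lt_asymm ((hS i hiS).2 j hjS) ((hT j hjT).2 i hiT)
  · refine hWO _ (hfW _ (subset_tsupport _ ?_))
    exact (hgV S x hx _ S.2.1.choose_spec).1.ne'
  · by_cases hx : x ∈ K
    · exact Or.inl (hgK x hx)
    · exact Or.inr (hKa x hx)

end ColouredPartition

/-! ### Completely positive rank is at most the covering dimension -/

section UpperBound

theorem IsMinimalProjection.exists_eq_single {ι : Type*} [Fintype ι] [DecidableEq ι]
    [PartialOrder (ι → ℂ)] [StarOrderedRing (ι → ℂ)] {e : ι → ℂ} (he : IsMinimalProjection e) :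
    ∃ i, e = Pi.single i 1 := by
  obtain ⟨i, hi⟩ := Function.ne_iff.1 he.2.1
  have h1 : e i = 1 := by
    have := congrFun he.1.isIdempotentElem.eq i
    exact mul_right_cancel₀ hi (by rw [one_mul]; exact this)
  refine ⟨i, ?_⟩
  have hq : IsStarProjection (Pi.single i 1 : ι → ℂ) := by
    refine ⟨?_, ?_⟩
    · rw [IsIdempotentElem, ← Pi.single_mul, one_mul]
    · ext j
      by_cases hj : j = i
      · subst hj; simp
      · simp [hj]
  have hle : (Pi.single i 1 : ι → ℂ) * e = Pi.single i 1 := by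
    ext j
    by_cases hj : j = i
    · subst hj; simp [h1]
    · simp [hj]
  rcases he.2.2 _ hq ((hq.le_iff_mul_eq he.1).2 hle) with h | h
  · simp at h
  · exact h.symm

theorem CStarMatrix.sum_apply {ι l n A : Type*} [AddCommMonoid A] (s : Finset ι)
    (f : ι → CStarMatrix l n A) (i : l) (j : n) : (∑ c ∈ s, f c) i j = ∑ c ∈ s, f c i j :=
  map_sum (⟨⟨fun M : CStarMatrix l n A => M i j, rfl⟩, fun _ _ => rfl⟩ : _ →+ A) f s

theorem ZeroAtInftyContinuousMap.sum_apply {X : Type u} [TopologicalSpace X] {ι : Type*}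
    (s : Finset ι) (f : ι → C₀(X, ℂ)) (x : X) : (∑ c ∈ s, f c) x = ∑ c ∈ s, f c x :=
  map_sum (⟨⟨fun f : C₀(X, ℂ) => f x, rfl⟩, fun _ _ => rfl⟩ : _ →+ ℂ) f s

/-- A family of positive elements gives a completely positive map from a finite-dimensional
commutative C⋆-algebra. -/
noncomputable def CompletelyPositiveMap.ofNonneg {ι A : Type*} [Fintype ι]
    [PartialOrder (ι → ℂ)] [StarOrderedRing (ι → ℂ)] [NonUnitalCStarAlgebra A] [PartialOrder A]
    [StarOrderedRing A] (h : ι → A) (hh : ∀ i, 0 ≤ h i) : (ι → ℂ) →CP A where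
  toLinearMap := ∑ i, (LinearMap.proj i : (ι → ℂ) →ₗ[ℂ] ℂ).smulRight (h i)
  map_cstarMatrix_nonneg' k M hM := by
    rw [StarOrderedRing.nonneg_iff] at hM
    induction hM using AddSubmonoid.closure_induction with
    | mem M hM =>
      obtain ⟨N, rfl⟩ := hM
      -- Writing each `h i` as `star (r i) * r i` turns the image of `star N * N` into a sum of
      -- squares.
      choose r hr using fun i => CStarAlgebra.nonneg_iff_eq_star_mul_self.1 (hh i)
      let P : ι → CStarMatrix (Fin k) (Fin k) A := fun i =>
        CStarMatrix.ofMatrix fun c b => N c b i • r i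
      have : (star N * N).map ⇑(∑ i, (LinearMap.proj i : (ι → ℂ) →ₗ[ℂ] ℂ).smulRight (h i)) =
          ∑ i, star (P i) * P i := by
        have hP (i : ι) (c b : Fin k) : P i c b = N c b i • r i := rfl
        ext a b
        rw [CStarMatrix.sum_apply]
        simp only [CStarMatrix.map_apply, CStarMatrix.mul_apply, CStarMatrix.star_apply, map_sum,
          LinearMap.sum_apply, LinearMap.smulRight_apply, LinearMap.proj_apply, Pi.mul_apply,
          Pi.star_apply, hP, star_smul, smul_mul_smul_comm, hr]
        exact Finset.sum_comm
      dsimp only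
      rw [this]
      exact Finset.sum_nonneg fun i _ => star_mul_self_nonneg _
    | zero =>
      refine le_of_eq ?_
      ext i j
      simp
    | add M N _ _ hM hN =>
      refine (add_nonneg hM hN).trans_eq ?_
      ext i j
      rw [CStarMatrix.map_apply, CStarMatrix.add_apply, CStarMatrix.add_apply, map_add]
      rfl

theorem CompletelyPositiveMap.ofNonneg_apply {ι A : Type*} [Fintype ι]
    [PartialOrder (ι → ℂ)] [StarOrderedRing (ι → ℂ)] [NonUnitalCStarAlgebra A] [PartialOrder A]
    [StarOrderedRing A] (h : ι → A) (hh : ∀ i, 0 ≤ h i) (y : ι → ℂ) :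
    CompletelyPositiveMap.ofNonneg h hh y = ∑ i, y i • h i := by
  change (∑ i, (LinearMap.proj i : (ι → ℂ) →ₗ[ℂ] ℂ).smulRight (h i)) y = _
  simp

/-- Evaluation at finitely many points. -/
noncomputable def ZeroAtInftyContinuousMap.evalHom {X : Type u} [TopologicalSpace X] {ι : Type*} (p : ι → X) :
    C₀(X, ℂ) →⋆ₙₐ[ℂ] (ι → ℂ) where
  toFun f i := f (p i)
  map_smul' c f := by ext; simp
  map_zero' := by ext; simp
  map_add' f g := by ext; simp
  map_mul' f g := by ext; simp
  map_star' f := by ext; simp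

variable {X : Type u} [TopologicalSpace X] [T2Space X] [LocallyCompactSpace X]
  [PartialOrder C₀(X, ℂ)] [StarOrderedRing C₀(X, ℂ)]

theorem CoveringDimLE.cpRankLE {n : ℤ} {m : ℕ} (hm : (m : ℤ) = n + 1) (h : CoveringDimLE X n) :
    CPRankLE C₀(X, ℂ) n := by
  classical
  intro k a ε hε
  obtain ⟨ι, _, p, g, col, hgc, hg0, hg1, hcol, hdisj, hosc, hcov⟩ :=
    h.exists_coloured_subpartition hm a (half_pos hε)
  let : PartialOrder (ι → ℂ) := CStarAlgebra.spectralOrder _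
  have : StarOrderedRing (ι → ℂ) := CStarAlgebra.spectralOrderedRing _
  let φ : (ι → ℂ) →CP C₀(X, ℂ) := CompletelyPositiveMap.ofNonneg
    (fun i => (g i).toC₀ (hgc i)) fun i => (g i).toC₀_nonneg (hgc i) (hg0 i)
  let ψ : C₀(X, ℂ) →CP (ι → ℂ) := CompletelyPositiveMapClass.toCompletelyPositiveLinearMap
    (ZeroAtInftyContinuousMap.evalHom p)
  have hφ (y : ι → ℂ) (x : X) : φ y x = ∑ i, y i * (g i x : ℂ) := by
    rw [CompletelyPositiveMap.ofNonneg_apply, ZeroAtInftyContinuousMap.sum_apply]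
    simp
  have hψ (f : C₀(X, ℂ)) (i : ι) : ψ f i = f (p i) := rfl
  refine ⟨ι → ℂ, inferInstance, inferInstance, inferInstance, ψ, φ, inferInstance, fun f => ?_,
    fun y => ?_, fun l => ?_, fun T hT hTe => ?_⟩
  · rw [pi_norm_le_iff_of_nonneg (norm_nonneg f)]
    exact fun i => f.norm_apply_le (p i)
  · refine ZeroAtInftyContinuousMap.norm_le_of_forall _ (norm_nonneg y) fun x => ?_
    rw [hφ]
    calc ‖∑ i, y i * (g i x : ℂ)‖ ≤ ∑ i, ‖y i * (g i x : ℂ)‖ := norm_sum_le _ _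
      _ ≤ ∑ i, ‖y‖ * g i x := Finset.sum_le_sum fun i _ => by
          rw [norm_mul, Complex.norm_real, Real.norm_eq_abs, abs_of_nonneg (hg0 i x)]
          exact mul_le_mul_of_nonneg_right (norm_le_pi_norm y i) (hg0 i x)
      _ ≤ ‖y‖ := by
          rw [← Finset.mul_sum]
          exact mul_le_of_le_one_right (norm_nonneg y) (hg1 x)
  · refine lt_of_le_of_lt (ZeroAtInftyContinuousMap.norm_le_of_forall _ (half_pos hε).le
      fun x => ?_) (half_lt_self hε)
    -- The first term is controlled by the oscillation on the supports; the second is nonzero only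
    -- where the partition falls short of one, and there `a l` is small.
    have hsplit : (φ (ψ (a l)) - a l) x =
        ∑ i, (a l (p i) - a l x) * (g i x : ℂ) - ((1 - ∑ i, g i x : ℝ) : ℂ) * a l x := by
      rw [ZeroAtInftyContinuousMap.sub_apply, hφ]
      simp only [hψ, sub_mul, Finset.sum_sub_distrib, ← Finset.mul_sum, Complex.ofReal_sub,
        Complex.ofReal_one, Complex.ofReal_sum]
      ring
    have h1 : ‖∑ i, (a l (p i) - a l x) * (g i x : ℂ)‖ ≤ (∑ i, g i x) * (ε / 2) := by
      rw [Finset.sum_mul]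
      refine norm_sum_le_of_le _ fun i _ => ?_
      rw [norm_mul, Complex.norm_real, Real.norm_eq_abs, abs_of_nonneg (hg0 i x), mul_comm]
      by_cases h0 : g i x = 0
      · simp [h0]
      · refine mul_le_mul_of_nonneg_left ?_ (hg0 i x)
        rw [norm_sub_rev]
        exact (hosc i x h0 l).le
    have h2 : ‖((1 - ∑ i, g i x : ℝ) : ℂ) * a l x‖ ≤ (1 - ∑ i, g i x) * (ε / 2) := by
      have h3 : 0 ≤ 1 - ∑ i, g i x := sub_nonneg.2 (hg1 x)
      rw [norm_mul, Complex.norm_real, Real.norm_eq_abs, abs_of_nonneg h3]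
      rcases hcov x with h0 | h0
      · simp [h0]
      · exact mul_le_mul_of_nonneg_left (h0 l).le h3
    rw [hsplit]
    refine (norm_sub_le _ _).trans ?_
    linarith
  · have hex : ∀ e : T, ∃ i, e.1 = Pi.single i 1 := fun e => (hTe.1 e.1 e.2).exists_eq_single
    choose s hs using hex
    have hsinj : Function.Injective s := fun e f hef => Subtype.ext (by rw [hs, hs, hef])
    -- Pigeonhole: `n + 2 = m + 1` projections against `m` colours.
    obtain ⟨e, -, f, -, hef, hc⟩ := Finset.exists_ne_map_eq_of_card_lt_of_maps_to
      (s := (Finset.univ : Finset T)) (t := Finset.Icc 1 m) (f := fun e => col (s e))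
      (by simp only [Nat.card_Icc, Finset.card_univ, Fintype.card_coe]; omega)
      (fun e _ => hcol _)
    have hval (e : T) (x : X) : φ e.1 x = (g (s e) x : ℂ) := by
      rw [hφ, hs e, Finset.sum_eq_single_of_mem (s e) (Finset.mem_univ _)]
      · simp
      · intro j _ hj
        simp [hj]
    have hzero (x : X) : (g (s e) x : ℂ) * (g (s f) x : ℂ) = 0 := by
      rw [← Complex.ofReal_mul, hdisj _ _ (hsinj.ne hef) hc x, Complex.ofReal_zero]
    refine ⟨e.1, e.2, f.1, f.2, ?_, ?_, ?_, ?_⟩ <;> ext x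
    · simp [hval, hzero]
    · simp [hval, mul_comm (g (s f) x : ℂ), hzero]
    · simp [hval, hzero]
    · simp [hval, hzero]

theorem coveringDimLE_iff_cpRankLE [SecondCountableTopology X] {n : ℤ} (hn : -1 ≤ n) :
    CoveringDimLE X n ↔ CPRankLE C₀(X, ℂ) n := by
  obtain ⟨m, hm⟩ : ∃ m : ℕ, (m : ℤ) = n + 1 := ⟨(n + 1).toNat, by omega⟩
  exact ⟨fun h => h.cpRankLE hm, fun h => .of_finite_refinement hm
    (exists_refinement_of_compact fun K hK k U hU hKU =>
      h.exists_refinement_of_isCompact hm hK hU hKU)⟩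

end UpperBound

theorem mainTheorem2 (X : Type u) [TopologicalSpace X] [T2Space X] [LocallyCompactSpace X]
    [SecondCountableTopology X] :
    coveringDim X = cpRank C₀(X, ℂ) := by
  let : PartialOrder C₀(X, ℂ) := CStarAlgebra.spectralOrder _
  have : StarOrderedRing C₀(X, ℂ) := CStarAlgebra.spectralOrderedRing _
  unfold coveringDim cpRank
  congr 1
  ext d
  refine exists_congr fun n => and_congr_right fun hn => and_congr_left fun _ => ?_
  exact coveringDimLE_iff_cpRankLE hn
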